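/- For $\mathrm{Im}\,\tau>0$, $\mathrm{Im}\,\sigma>0$ put $q=e^{2\pi i\tau}$, $r=e^{2\pi i\sigma}$, $x=e^{2\pi i z}$ and let \[ \theta_0(z,\tau)=\prod_{j=0}^\infty(1-xq^{j})(1-x^{-1}q^{j+1}),\qquad \Gamma(z,\tau,\sigma)=\prod_{j,k=0}^\infty\frac{1-x^{-1}q^{j+1}r^{k+1}}{1-xq^{j}r^{k}} \] be the theta function and the elliptic gamma function, and let \[ Q(z;\tau,\sigma)=\frac{z^3}{3\tau\sigma}-\frac{\tau+\sigma-1}{2\tau\sigma}z^2+\frac{\tau^2+\sigma^2+3\tau\sigma-3\tau-3\sigma+1}{6\tau\sigma}z+\frac1{12}(\tau+\sigma-1)(\tau^{-1}+\sigma^{-1}-1). \] For $\mathrm{Im}\,t<0$ let \[ \psi(t)=\exp\left(t\ln(1-e^{-2\pi i t})-\frac1{2\pi i}\mathrm{Li}_2(e^{-2\pi i t})\right),\qquad \mathrm{Li}_2(x)=\sum_{j=1}^\infty\frac{x^j}{j^2}, \] where $\ln(1-x)=-\sum_{j\ge1}x^j/j$ for $|x|<1$. Then $\psi$ has a unique meromorphic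 continuation to $\mathbb C$, again denoted by $\psi$. For all $\tau\in\mathbb C$ with $\mathrm{Im}\,\tau>0$ and all $z\in\mathbb C\setminus(\mathbb Z+\tau\mathbb Z)$, the infinite product below converges unconditionally, and \[ \Gamma(z,\tau,\tau)=\frac{e^{-\pi i Q(z;\tau,\tau)}}{\theta_0\left(\frac z\tau,-\frac1\tau\right)}\prod_{k=0}^\infty\frac{\psi\left(\frac{k+1+z}\tau\right)}{\psi\left(\frac{k-z}\tau\right)}. \] -/

import Mathlib

noncomputable section

/-- The product `(x; q) = ∏_{j ≥ 0} (1 - x q ^ j)`, for `|q| < 1`. -/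
def qProd (x q : ℂ) : ℂ :=
  ∏' j : ℕ, (1 - x * q ^ j)

/-- The double product `(x; q, r) = ∏_{j, k ≥ 0} (1 - x q ^ j r ^ k)`, for `|q|, |r| < 1`. -/
def qrProd (x q r : ℂ) : ℂ :=
  ∏' p : ℕ × ℕ, (1 - x * q ^ p.1 * r ^ p.2)

/-- The exponential `e(z) = e ^ (2 π i z)`. -/
def cexpTwoPiI (z : ℂ) : ℂ :=
  Complex.exp (2 * (Real.pi : ℂ) * Complex.I * z)

/-- The theta function `θ₀(z, τ) = (x; q) (q / x; q)`, with `x = e(z)`, `q = e(τ)`,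
for `Im τ > 0`. -/
def thetaZero (z τ : ℂ) : ℂ :=
  qProd (cexpTwoPiI z) (cexpTwoPiI τ) * qProd (cexpTwoPiI τ / cexpTwoPiI z) (cexpTwoPiI τ)

/-- The elliptic gamma function `Γ(z, τ, σ) = (q r / x; q, r) / (x; q, r)`, with `x = e(z)`,
`q = e(τ)`, `r = e(σ)`, for `Im τ > 0` and `Im σ > 0`. -/
def ellipticGamma (z τ σ : ℂ) : ℂ :=
  qrProd (cexpTwoPiI τ * cexpTwoPiI σ / cexpTwoPiI z) (cexpTwoPiI τ) (cexpTwoPiI σ) /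
    qrProd (cexpTwoPiI z) (cexpTwoPiI τ) (cexpTwoPiI σ)

/-- The function `Q(z; τ, σ)`, a cubic polynomial in `z`. -/
def cubicQ (z τ σ : ℂ) : ℂ :=
  z ^ 3 / (3 * τ * σ) - (τ + σ - 1) / (2 * τ * σ) * z ^ 2
    + (τ ^ 2 + σ ^ 2 + 3 * τ * σ - 3 * τ - 3 * σ + 1) / (6 * τ * σ) * z
    + 1 / 12 * (τ + σ - 1) * (τ⁻¹ + σ⁻¹ - 1)

/-- The dilogarithm `Li₂(x) = ∑_{j ≥ 1} x ^ j / j ^ 2`, for `|x| ≤ 1`. -/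
def dilog (x : ℂ) : ℂ :=
  ∑' j : ℕ, x ^ (j + 1) / ((j : ℂ) + 1) ^ 2

/-- The expression `exp (t ln (1 - e(-t)) - Li₂(e(-t)) / (2 π i))`, for `Im t < 0`. There
`|e(-t)| < 1`, so that the principal branch of the logarithm is `ln (1 - x) = -∑ x ^ j / j`. -/
def psiLower (t : ℂ) : ℂ :=
  Complex.exp (t * Complex.log (1 - cexpTwoPiI (-t))
    - 1 / (2 * (Real.pi : ℂ) * Complex.I) * dilog (cexpTwoPiI (-t)))

/-- `ψ` is a meromorphic continuation to `ℂ` of `psiLower` on the lower half plane. The normal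
form only says that `ψ` takes its limit as value wherever it has no pole (and the value `0`
at its poles), so that the values of `ψ` are those of the meromorphic function. -/
def IsPsiContinuation (ψ : ℂ → ℂ) : Prop :=
  MeromorphicNFOn ψ Set.univ ∧ Set.EqOn ψ psiLower {t : ℂ | t.im < 0}

end

noncomputable section

open Complex Filter Topology Set

/-! The continuation is explicit. Let N = `psiNum` be the genus 2 Weierstrass product with a zero of
order n at each positive integer n; then ψ(t) = exp(πi/12 - πi t²/2 + t) N(t)/N(-t). By the partial
fractions of the cotangent its logarithmic derivative is t(π cot πt - πi), which is also that of
`psiLower`, and the limit at 0, where Li₂(1) = π²/6, fixes the constant (`psi_eq_psiLower`). Two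
functional equations result: ψ(t)ψ(-t) = exp(-πi(t² - 1/6)) and ψ(t+1) = ψ(t)(1 - e(-t)).

The product converges because Im((k+1+z)/τ) tends linearly to -∞, so that log ψ decays exponentially
along the factors.

For the identity, the formula is taken at z + τ, where θ₀ is absorbed into the ψ-products
(`psiQuotient_add_tau`). The quotient `gammaRatio` of its two sides has period 1 and is multiplied
by `thetaRatio` under z ↦ z + τ. The latter is the quotient of the two sides of the modular
transformation of θ₀; it is doubly periodic and holomorphic, hence a constant c, and the half
periods give c³ = 1. On a period parallelogram around 0, `gammaRatio` has neither zeros nor poles,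
so its logarithmic derivative is constant and it equals exp(αz), being 1 at 0. The shifts give
exp(α) = 1 and exp(ατ) = c; with c³ = 1 and Im τ > 0 this forces α = 0 and c = 1. The modular law of
θ₀ is thus a by-product rather than an input. -/

/-! ### The Weierstrass product for ψ -/

/-- The factor with a zero of order `k + 1` at `k + 1` in the product for `psiNum`. -/
def psiFactor (k : ℕ) (t : ℂ) : ℂ :=
  ((1 - t / (k + 1)) * exp (t / (k + 1) + (t / (k + 1)) ^ 2 / 2)) ^ (k + 1)

/-- The entire function with zeros of order `n` at the positive integers `n`. -/
def psiNum (t : ℂ) : ℂ := ∏' k : ℕ, psiFactor k t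

/-- The meromorphic continuation of `psiLower`. -/
def psi (t : ℂ) : ℂ :=
  exp (Real.pi * I / 12 - Real.pi * I * t ^ 2 / 2 + t) * psiNum t / psiNum (-t)

lemma natCast_add_one_complex_ne_zero (k : ℕ) : (k : ℂ) + 1 ≠ 0 := Nat.cast_add_one_ne_zero k

lemma differentiable_psiFactor (k : ℕ) : Differentiable ℂ (psiFactor k) := by
  unfold psiFactor; fun_prop

lemma psiFactor_eq_zero_iff (k : ℕ) (t : ℂ) : psiFactor k t = 0 ↔ t = k + 1 := by
  have := natCast_add_one_complex_ne_zero k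
  simp only [psiFactor, pow_eq_zero_iff', mul_eq_zero, exp_ne_zero, or_false, sub_eq_zero,
    ne_eq, Nat.add_eq_zero_iff, one_ne_zero, and_false, not_false_eq_true, and_true]
  rw [eq_div_iff this]
  constructor <;> intro h <;> linear_combination -h

lemma norm_natCast_add_one (k : ℕ) : ‖(k : ℂ) + 1‖ = k + 1 := by
  have := Complex.norm_natCast (k + 1)
  push_cast at this
  exact this

/-- With u = t/(k+1), the logarithm of the factor is k + 1 times the tail of log(1 - u) beyond its
quadratic term, hence O(R³/(k+1)²); genus 2 is what compensates for the multiplicity k + 1. The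
condition 2R³ ≤ k ensures |u| ≤ 1/2 and keeps the exponent in the unit disc, where |exp w - 1| ≤
2|w|. -/
lemma norm_psiFactor_sub_one_le {k : ℕ} {t : ℂ} {R : ℝ} (hR : 1 ≤ R) (ht : ‖t‖ ≤ R)
    (hk : 2 * R ^ 3 ≤ k) : ‖psiFactor k t - 1‖ ≤ 2 * R ^ 3 / ((k : ℝ) + 1) ^ 2 := by
  have hk0 := natCast_add_one_complex_ne_zero k
  set u : ℂ := t / (k + 1) with hu
  have hR3 : R ≤ R ^ 3 := by nlinarith [mul_nonneg (by linarith : 0 ≤ R) (by nlinarith : 0 ≤ R ^ 2 - 1)]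
  have hun : ‖u‖ ≤ R / (k + 1) := by
    rw [hu, norm_div, norm_natCast_add_one]; gcongr
  have hu2 : ‖u‖ ≤ 1 / 2 := hun.trans (by rw [div_le_div_iff₀ (by positivity) (by norm_num)]; linarith)
  have hlog := norm_log_sub_logTaylor_le 2 (z := -u) (by rw [norm_neg]; linarith)
  have hT : logTaylor (2 + 1) (-u) = -u - u ^ 2 / 2 := by
    simp [logTaylor_succ, logTaylor_zero]; ring
  rw [hT, norm_neg] at hlog
  have hne : 1 + -u ≠ 0 := by
    intro h
    have : u = 1 := by linear_combination -h
    rw [this] at hu2; norm_num at hu2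
  have hF : psiFactor k t = exp ((k + 1) * (log (1 + -u) - (-u - u ^ 2 / 2))) := by
    rw [psiFactor, ← hu, show (1 : ℂ) - u = 1 + -u by ring]
    nth_rewrite 1 [← exp_log hne]
    rw [← exp_add, ← exp_nat_mul]
    congr 1; push_cast; ring
  have hinv : (1 - ‖u‖)⁻¹ ≤ 2 := by
    rw [inv_le_comm₀ (by linarith) (by norm_num)]; linarith
  have hw : ‖((k : ℂ) + 1) * (log (1 + -u) - (-u - u ^ 2 / 2))‖ ≤ R ^ 3 / ((k : ℝ) + 1) ^ 2 := by
    rw [norm_mul, norm_natCast_add_one]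
    calc ((k : ℝ) + 1) * ‖log (1 + -u) - (-u - u ^ 2 / 2)‖
        ≤ (k + 1) * (‖u‖ ^ (2 + 1) * (1 - ‖u‖)⁻¹ / ((2 : ℕ) + 1)) := by gcongr
      _ ≤ (k + 1) * ((R / (k + 1)) ^ (2 + 1) * 2 / ((2 : ℕ) + 1)) := by
          have : 0 ≤ (1 - ‖u‖)⁻¹ := inv_nonneg.2 (by linarith)
          gcongr
      _ = 2 / 3 * (R ^ 3 / ((k : ℝ) + 1) ^ 2) := by push_cast; field_simp; norm_num
      _ ≤ 1 * (R ^ 3 / ((k : ℝ) + 1) ^ 2) := by gcongr; norm_num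
      _ = _ := one_mul _
  rw [hF]
  refine (norm_exp_sub_one_le (hw.trans ?_)).trans ?_
  · rw [div_le_one (by positivity)]; nlinarith
  · rw [mul_div_assoc]; gcongr

lemma summable_const_div_succ_sq (c : ℝ) : Summable fun k : ℕ => c / ((k : ℝ) + 1) ^ 2 := by
  have := (summable_nat_add_iff (f := fun n : ℕ => c / (n : ℝ) ^ 2) 1).2
    (by simpa [div_eq_mul_inv] using (Real.summable_nat_pow_inv.2 one_lt_two).mul_left c)
  simpa using this

lemma multipliableLocallyUniformlyOn_psiFactor (R : ℝ) (hR : 1 ≤ R) :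
    MultipliableLocallyUniformlyOn psiFactor (Metric.ball 0 R) := by
  have := Summable.multipliableLocallyUniformlyOn_nat_one_add (f := fun k t => psiFactor k t - 1)
    (K := Metric.ball 0 R) Metric.isOpen_ball (summable_const_div_succ_sq (2 * R ^ 3)) ?_ ?_
  · simpa using this
  · filter_upwards [eventually_ge_atTop ⌈2 * R ^ 3⌉₊] with k hk t ht
    exact norm_psiFactor_sub_one_le hR (mem_ball_zero_iff.1 ht).le
      ((Nat.le_ceil _).trans (by exact_mod_cast hk))
  · intro k
    exact ((differentiable_psiFactor k).continuous.sub continuous_const).continuousOn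

lemma differentiable_psiNum : Differentiable ℂ psiNum := by
  intro t
  have h := (multipliableLocallyUniformlyOn_psiFactor (‖t‖ + 1)
    (by linarith [norm_nonneg t])).hasProdLocallyUniformlyOn
  have hd : DifferentiableOn ℂ psiNum (Metric.ball 0 (‖t‖ + 1)) :=
    TendstoLocallyUniformlyOn.differentiableOn h (Eventually.of_forall fun s =>
      (Differentiable.fun_finsetProd fun i _ => differentiable_psiFactor i).differentiableOn)
      Metric.isOpen_ball
  exact hd.differentiableAt (Metric.isOpen_ball.mem_nhds (by simp))

lemma summable_norm_psiFactor_sub_one (t : ℂ) : Summable fun k => ‖psiFactor k t - 1‖ := by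
  refine Summable.of_norm_bounded_eventually_nat
    (summable_const_div_succ_sq (2 * (‖t‖ + 1) ^ 3)) ?_
  filter_upwards [eventually_ge_atTop ⌈2 * (‖t‖ + 1) ^ 3⌉₊] with k hk
  rw [norm_norm]
  exact norm_psiFactor_sub_one_le (by linarith [norm_nonneg t]) (by linarith)
      ((Nat.le_ceil _).trans (by exact_mod_cast hk))

lemma psiNum_ne_zero {t : ℂ} (ht : ∀ k : ℕ, t ≠ k + 1) : psiNum t ≠ 0 := by
  have := tprod_one_add_ne_zero_of_summable (f := fun k => psiFactor k t - 1)
    (fun k => by simpa [psiFactor_eq_zero_iff] using ht k) (summable_norm_psiFactor_sub_one t)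
  simpa [psiNum] using this

lemma psiNum_zero : psiNum 0 = 1 := by simp [psiNum, psiFactor]

lemma psi_zero : psi 0 = exp (Real.pi * I / 12) := by simp [psi, psiNum_zero]

lemma psiNum_ne_zero_of_im_ne_zero {t : ℂ} (ht : t.im ≠ 0) : psiNum t ≠ 0 :=
  psiNum_ne_zero fun k h => ht (by simp [h])

lemma logDeriv_psiFactor {k : ℕ} {t : ℂ} (ht : t ≠ k + 1) :
    logDeriv (psiFactor k) t = -t ^ 2 / ((k + 1) * (k + 1 - t)) := by
  have hk0 := natCast_add_one_complex_ne_zero k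
  have h1 : ((k : ℂ) + 1 - t) ≠ 0 := sub_ne_zero.2 ht.symm
  have h2 : (1 - t / ((k : ℂ) + 1)) ≠ 0 := by
    rw [one_sub_div hk0]; exact div_ne_zero h1 hk0
  have hd1 : HasDerivAt (fun t : ℂ => 1 - t / ((k : ℂ) + 1)) (-(1 / ((k : ℂ) + 1))) t := by
    simpa using ((hasDerivAt_id t).div_const ((k : ℂ) + 1)).const_sub 1
  have hd2 : HasDerivAt (fun t : ℂ => exp (t / ((k : ℂ) + 1) + (t / (k + 1)) ^ 2 / 2))
      (exp (t / ((k : ℂ) + 1) + (t / (k + 1)) ^ 2 / 2) * (1 / (k + 1) + t / (k + 1) ^ 2)) t := by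
    refine HasDerivAt.cexp ?_
    have h := (hasDerivAt_id t).div_const ((k : ℂ) + 1)
    refine (h.add ((h.pow 2).div_const 2)).congr_deriv ?_
    simp; field_simp
  unfold psiFactor
  rw [logDeriv_fun_pow (by fun_prop), 
    logDeriv_mul (f := fun t => 1 - t / ((k : ℂ) + 1))
      (g := fun t => exp (t / ((k : ℂ) + 1) + (t / (k + 1)) ^ 2 / 2)) t h2 (exp_ne_zero _)
      (by fun_prop) (by fun_prop), logDeriv_apply, logDeriv_apply, hd1.deriv, hd2.deriv, mul_div_cancel_left₀ _ (exp_ne_zero _)]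
  push_cast
  rw [one_sub_div hk0]
  field_simp
  ring

lemma summable_logDeriv_psiFactor (t : ℂ) :
    Summable fun k : ℕ => -t ^ 2 / (((k : ℂ) + 1) * (k + 1 - t)) := by
  refine Summable.of_norm_bounded_eventually_nat (summable_const_div_succ_sq (2 * ‖t‖ ^ 2)) ?_
  filter_upwards [eventually_ge_atTop ⌈2 * ‖t‖⌉₊] with k hk
  have hk' : 2 * ‖t‖ ≤ k := (Nat.le_ceil _).trans (by exact_mod_cast hk)
  have h := norm_sub_norm_le ((k : ℂ) + 1) t
  rw [norm_natCast_add_one] at h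
  rw [norm_div, norm_mul, norm_neg, norm_pow, norm_natCast_add_one]
  have h2 : ((k : ℝ) + 1) / 2 ≤ ‖(k : ℂ) + 1 - t‖ := by linarith
  calc ‖t‖ ^ 2 / (((k : ℝ) + 1) * ‖(k : ℂ) + 1 - t‖)
      ≤ ‖t‖ ^ 2 / (((k : ℝ) + 1) * (((k : ℝ) + 1) / 2)) := by gcongr
    _ = _ := by field_simp

lemma logDeriv_psiNum {t : ℂ} (ht : t.im ≠ 0) :
    logDeriv psiNum t = ∑' k : ℕ, -t ^ 2 / (((k : ℂ) + 1) * (k + 1 - t)) := by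
  have hne : ∀ k : ℕ, t ≠ k + 1 := fun k h => ht (by simp [h])
  have heq : ∀ k, logDeriv (psiFactor k) t = -t ^ 2 / (((k : ℂ) + 1) * (k + 1 - t)) :=
    fun k => logDeriv_psiFactor (hne k)
  have := logDeriv_tprod_eq_tsum (s := Metric.ball 0 (‖t‖ + 1)) Metric.isOpen_ball (x := t)
    (by simp) (f := psiFactor) (fun i => by simpa [psiFactor_eq_zero_iff] using hne i)
    (fun i => (differentiable_psiFactor i).differentiableOn)
    (by simpa only [heq] using summable_logDeriv_psiFactor t)
    (multipliableLocallyUniformlyOn_psiFactor _ (by linarith [norm_nonneg t]))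
    (psiNum_ne_zero hne)
  rw [tsum_congr heq] at this
  exact this

/-- The k-th terms of the series for `psiNum` at t and at -t combine to t times a pair of cotangent
partial fractions. The summand t in the exponent of `psi` contributes the 1 that matches the polar
term 1/t of π cot πt. -/
lemma logDeriv_psi {t : ℂ} (ht : t.im ≠ 0) :
    logDeriv psi t = -(Real.pi * I * t) + t * (Real.pi * cot (Real.pi * t)) := by
  have htz : t ∈ integerComplement := by
    rintro ⟨n, rfl⟩; simp at ht
  have ht0 : t ≠ 0 := by rintro rfl; simp at ht
  have hn : (-t).im ≠ 0 := by simpa using ht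
  have e1 : HasDerivAt (fun t : ℂ => exp (Real.pi * I / 12 - Real.pi * I * t ^ 2 / 2 + t))
      (exp (Real.pi * I / 12 - Real.pi * I * t ^ 2 / 2 + t) * (-(Real.pi * I * t) + 1)) t := by
    refine HasDerivAt.cexp ?_
    have h := ((((hasDerivAt_id t).pow 2).const_mul (Real.pi * I)).div_const 2).const_sub
      (Real.pi * I / 12)
    refine (h.add (hasDerivAt_id t)).congr_deriv ?_
    simp; ring
  have hneg : logDeriv (fun t => psiNum (-t)) t = - logDeriv psiNum (-t) := by
    have := logDeriv_comp (f := psiNum) (g := fun t : ℂ => -t) (x := t)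
      differentiable_psiNum.differentiableAt (by fun_prop)
    simpa [Function.comp_def] using this
  have hd : Differentiable ℂ (fun t => psiNum (-t)) :=
    differentiable_psiNum.comp differentiable_neg
  have hdn := differentiable_psiNum
  unfold psi
  rw [logDeriv_div
    (f := fun t => exp (Real.pi * I / 12 - Real.pi * I * t ^ 2 / 2 + t) * psiNum t)
    (g := fun t => psiNum (-t)) t
    (mul_ne_zero (exp_ne_zero _) (psiNum_ne_zero_of_im_ne_zero ht))
    (psiNum_ne_zero_of_im_ne_zero hn) (by fun_prop) (hd t),
    logDeriv_mul (f := fun t => exp (Real.pi * I / 12 - Real.pi * I * t ^ 2 / 2 + t))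
    (g := psiNum) t (exp_ne_zero _) (psiNum_ne_zero_of_im_ne_zero ht) (by fun_prop)
    (hdn t), logDeriv_apply, e1.deriv, mul_div_cancel_left₀ _ (exp_ne_zero _),
    hneg, logDeriv_psiNum ht, logDeriv_psiNum hn, sub_neg_eq_add, add_assoc,
    ← (summable_logDeriv_psiFactor t).tsum_add (summable_logDeriv_psiFactor (-t))]
  have hcot := cot_series_rep' htz
  have : ∀ k : ℕ, -t ^ 2 / (((k : ℂ) + 1) * (k + 1 - t)) + -(-t) ^ 2 / ((k + 1) * (k + 1 - -t)) =
      t * (1 / (t - (k + 1)) + 1 / (t + (k + 1))) := by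
    intro k
    have h0 := natCast_add_one_complex_ne_zero k
    have h1 : t - (k + 1) ≠ 0 := fun h => ht (by rw [sub_eq_zero.1 h]; simp)
    have h2 : t + (k + 1) ≠ 0 := fun h => ht (by rw [eq_neg_of_add_eq_zero_left h]; simp)
    have h3 : (k : ℂ) + 1 - t ≠ 0 := fun h => h1 (by linear_combination -h)
    have h4 : (k : ℂ) + 1 - -t ≠ 0 := fun h => h2 (by linear_combination h)
    field_simp
    ring
  rw [tsum_congr this, tsum_mul_left, ← hcot]
  field_simp
  ring

/-! ### The exponential, the dilogarithm and the logarithm of `psiLower` -/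

lemma norm_cexpTwoPiI (z : ℂ) : ‖cexpTwoPiI z‖ = Real.exp (-(2 * Real.pi * z.im)) := by
  rw [cexpTwoPiI, norm_exp]; simp

lemma cexpTwoPiI_ne_zero (z : ℂ) : cexpTwoPiI z ≠ 0 := exp_ne_zero _

lemma cexpTwoPiI_add (z w : ℂ) : cexpTwoPiI (z + w) = cexpTwoPiI z * cexpTwoPiI w := by
  simp [cexpTwoPiI, mul_add, exp_add]

lemma cexpTwoPiI_sub (z w : ℂ) : cexpTwoPiI (z - w) = cexpTwoPiI z / cexpTwoPiI w := by
  simp [cexpTwoPiI, mul_sub, exp_sub]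

lemma cexpTwoPiI_neg (z : ℂ) : cexpTwoPiI (-z) = (cexpTwoPiI z)⁻¹ := by
  simp [cexpTwoPiI, exp_neg]

lemma cexpTwoPiI_natCast_mul (n : ℕ) (z : ℂ) : cexpTwoPiI (n * z) = cexpTwoPiI z ^ n := by
  rw [cexpTwoPiI, cexpTwoPiI, ← exp_nat_mul]; ring_nf

lemma cexpTwoPiI_eq_one_iff (z : ℂ) : cexpTwoPiI z = 1 ↔ ∃ n : ℤ, z = n := by
  rw [cexpTwoPiI, exp_eq_one_iff]
  have : 2 * (Real.pi : ℂ) * I ≠ 0 := two_pi_I_ne_zero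
  refine exists_congr fun n => ?_
  rw [mul_comm, mul_left_inj' this]

lemma cexpTwoPiI_one : cexpTwoPiI 1 = 1 := (cexpTwoPiI_eq_one_iff 1).2 ⟨1, by simp⟩

lemma cexpTwoPiI_zero : cexpTwoPiI 0 = 1 := by simp [cexpTwoPiI]

lemma norm_cexpTwoPiI_lt_one {z : ℂ} (hz : 0 < z.im) : ‖cexpTwoPiI z‖ < 1 := by
  rw [norm_cexpTwoPiI, Real.exp_lt_one_iff]
  have := Real.pi_pos
  nlinarith [mul_pos this hz]

lemma differentiable_cexpTwoPiI : Differentiable ℂ cexpTwoPiI := by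
  unfold cexpTwoPiI; fun_prop

lemma hasDerivAt_cexpTwoPiI_neg (t : ℂ) : HasDerivAt (fun t => cexpTwoPiI (-t))
    (-(2 * Real.pi * I) * cexpTwoPiI (-t)) t := by
  unfold cexpTwoPiI
  refine (((hasDerivAt_id t).neg.const_mul (2 * (Real.pi : ℂ) * I)).cexp).congr_deriv ?_
  simp; ring

lemma summable_dilog_bound : Summable fun n : ℕ => 1 / ((n : ℝ) + 1) ^ 2 :=
  summable_const_div_succ_sq 1

lemma norm_dilog_term_le {x : ℂ} (hx : ‖x‖ ≤ 1) (n : ℕ) :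
    ‖x ^ (n + 1) / ((n : ℂ) + 1) ^ 2‖ ≤ 1 / ((n : ℝ) + 1) ^ 2 := by
  rw [norm_div, norm_pow, norm_pow, norm_natCast_add_one]
  gcongr
  exact pow_le_one₀ (norm_nonneg _) hx

lemma continuousOn_dilog : ContinuousOn dilog (Metric.closedBall 0 1) := by
  unfold dilog
  refine continuousOn_tsum (fun n => by fun_prop) summable_dilog_bound fun n x hx => ?_
  exact norm_dilog_term_le (by simpa using hx) n

lemma dilog_one : dilog 1 = (Real.pi : ℂ) ^ 2 / 6 := by
  have h := (hasSum_nat_add_iff' 1).2 hasSum_zeta_two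
  have h2 := Complex.hasSum_ofReal.2 h
  simp only [Finset.range_one, Finset.sum_singleton] at h2
  push_cast at h2
  rw [dilog]
  have := h2.tsum_eq
  simpa using this

lemma hasDerivAt_dilog {x : ℂ} (hx : ‖x‖ < 1) (hx0 : x ≠ 0) :
    HasDerivAt dilog (-log (1 - x) / x) x := by
  obtain ⟨r, hxr, hr⟩ := exists_between hx
  have hr0 : 0 ≤ r := (norm_nonneg x).trans hxr.le
  have hd := hasDerivAt_tsum_of_isPreconnected (u := fun n => r ^ n) (t := Metric.ball (0 : ℂ) r)
    (g := fun (n : ℕ) (x : ℂ) => x ^ (n + 1) / ((n : ℂ) + 1) ^ 2)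
    (g' := fun (n : ℕ) (x : ℂ) => x ^ n / ((n : ℂ) + 1)) (y₀ := 0) (y := x)
    (summable_geometric_of_lt_one hr0 hr) Metric.isOpen_ball (convex_ball _ _).isPreconnected
    ?_ ?_ (by simpa using (norm_nonneg x).trans_lt hxr) (by simp)
    (by simpa using hxr)
  · have hs := (hasSum_taylorSeries_neg_log' hx).div_const x
    have : ∀ n : ℕ, x ^ (n + 1) / ((n : ℂ) + 1) / x = x ^ n / (n + 1) := fun n => by
      rw [pow_succ]; field_simp
    simp only [this] at hs
    rw [hs.tsum_eq] at hd
    exact hd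
  · intro n y _
    have hn := natCast_add_one_complex_ne_zero n
    refine ((hasDerivAt_pow (n + 1) y).div_const _).congr_deriv ?_
    push_cast; field_simp
  · intro n y hy
    rw [norm_div, norm_pow, norm_natCast_add_one]
    have hy' : ‖y‖ ≤ r := (mem_ball_zero_iff.1 hy).le
    calc ‖y‖ ^ n / ((n : ℝ) + 1) ≤ r ^ n / 1 := by gcongr; linarith [n.cast_nonneg (α := ℝ)]
      _ = r ^ n := div_one _

/-- The logarithm of `psiLower`. -/
def logPsiLower (t : ℂ) : ℂ :=
  t * log (1 - cexpTwoPiI (-t)) - 1 / (2 * (Real.pi : ℂ) * I) * dilog (cexpTwoPiI (-t))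

lemma psiLower_eq_exp (t : ℂ) : psiLower t = exp (logPsiLower t) := rfl

lemma norm_cexpTwoPiI_neg_lt_one {t : ℂ} (ht : t.im < 0) : ‖cexpTwoPiI (-t)‖ < 1 :=
  norm_cexpTwoPiI_lt_one (by simpa using ht)

/-- The derivative of the dilogarithm term cancels the log(1 - x) that comes from differentiating
the factor t, so only a rational function of x = e(-t) remains beside t. -/
lemma hasDerivAt_logPsiLower {t : ℂ} (ht : t.im < 0) : HasDerivAt logPsiLower
    (t * (2 * Real.pi * I * cexpTwoPiI (-t) / (1 - cexpTwoPiI (-t)))) t := by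
  have hx := norm_cexpTwoPiI_neg_lt_one ht
  have hx0 := cexpTwoPiI_ne_zero (-t)
  have hpi : (2 * (Real.pi : ℂ) * I) ≠ 0 := two_pi_I_ne_zero
  have hs : 1 - cexpTwoPiI (-t) ∈ slitPlane := by
    rw [sub_eq_add_neg]
    exact mem_slitPlane_of_norm_lt_one (by rwa [norm_neg])
  have h1x := slitPlane_ne_zero hs
  have h1 := ((hasDerivAt_cexpTwoPiI_neg t).const_sub 1).clog hs
  have h2 := (hasDerivAt_dilog hx hx0).comp t (hasDerivAt_cexpTwoPiI_neg t)
  refine (((hasDerivAt_id t).mul h1).sub (h2.const_mul (1 / (2 * (Real.pi : ℂ) * I)))).congr_deriv ?_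
  simp only [id]
  generalize cexpTwoPiI (-t) = x at *
  generalize log (1 - x) = l at *
  generalize 2 * (Real.pi : ℂ) * I = p at *
  field_simp
  ring

lemma logDeriv_psiLower {t : ℂ} (ht : t.im < 0) : logDeriv psiLower t =
    t * (2 * Real.pi * I * cexpTwoPiI (-t) / (1 - cexpTwoPiI (-t))) := by
  have h := (hasDerivAt_logPsiLower ht).cexp
  have : psiLower = fun t => exp (logPsiLower t) := funext psiLower_eq_exp
  rw [logDeriv_apply, this, h.deriv, mul_div_cancel_left₀ _ (exp_ne_zero _)]

lemma isOpen_lower : IsOpen {t : ℂ | t.im < 0} := isOpen_lt continuous_im continuous_const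

lemma isPreconnected_lower : IsPreconnected {t : ℂ | t.im < 0} :=
  (convex_halfSpace_im_lt 0).isPreconnected

lemma differentiableAt_psi {t : ℂ} (ht : ∀ k : ℕ, -t ≠ k + 1) : DifferentiableAt ℂ psi t := by
  have hd : Differentiable ℂ (fun t => psiNum (-t)) :=
    differentiable_psiNum.comp differentiable_neg
  have := differentiable_psiNum
  unfold psi
  exact DifferentiableAt.div (by fun_prop) (hd t) (psiNum_ne_zero ht)

lemma psi_ne_zero {t : ℂ} (h1 : ∀ k : ℕ, t ≠ k + 1) (h2 : ∀ k : ℕ, -t ≠ k + 1) : psi t ≠ 0 :=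
  div_ne_zero (mul_ne_zero (exp_ne_zero _) (psiNum_ne_zero h1)) (psiNum_ne_zero h2)

/-! ### Identification of `psi` as the unique continuation -/

/-- log(1 - w)/w converges as w → 0, while w log w → 0. Along `lowerPath` the term t ln(1 - e(-t))
is a constant multiple of this product. -/
lemma tendsto_log_mul_log_one_sub :
    Tendsto (fun w : ℝ => Real.log (1 - w) * Real.log w) (𝓝[>] 0) (𝓝 0) := by
  have h1 : Tendsto (fun w : ℝ => w * Real.log w) (𝓝[>] 0) (𝓝 0) := by
    simpa using (Real.continuous_mul_log.tendsto 0).mono_left (nhdsWithin_le_nhds (s := Ioi 0))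
  have h2 : HasDerivAt (fun w : ℝ => Real.log (1 - w)) (-1) 0 := by
    refine (((hasDerivAt_id (0 : ℝ)).const_sub 1).log (by simp)).congr_deriv (by simp)
  have h3 := (hasDerivAt_iff_tendsto_slope.1 h2).mono_left
    (nhdsWithin_mono (0 : ℝ) (fun x (hx : 0 < x) => hx.ne' : Ioi (0 : ℝ) ⊆ {0}ᶜ))
  have h4 := h3.mul h1
  rw [mul_zero] at h4
  refine h4.congr' ?_
  filter_upwards [self_mem_nhdsWithin] with w hw
  have : w ≠ 0 := (show (0 : ℝ) < w from hw).ne'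
  simp only [slope_def_field, sub_zero, Real.log_one]
  field_simp

/-- A path in the lower half plane ending at `0`, along which `e(-t) = 1 - w`. -/
def lowerPath (w : ℝ) : ℂ := ((Real.log (1 - w) / (2 * Real.pi) : ℝ) : ℂ) * I

lemma cexpTwoPiI_neg_lowerPath {w : ℝ} (hw : w < 1) : cexpTwoPiI (-lowerPath w) = 1 - w := by
  have hpi : (Real.pi : ℂ) ≠ 0 := ofReal_ne_zero.2 Real.pi_ne_zero
  have : 2 * (Real.pi : ℂ) * I * -lowerPath w = ((Real.log (1 - w) : ℝ) : ℂ) := by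
    rw [lowerPath]; push_cast; field_simp; rw [I_sq]; ring
  rw [cexpTwoPiI, this, ← ofReal_exp, Real.exp_log (by linarith)]
  push_cast; rfl

lemma lowerPath_im_neg {w : ℝ} (h0 : 0 < w) (h1 : w < 1) : (lowerPath w).im < 0 := by
  have : Real.log (1 - w) < 0 := Real.log_neg (by linarith) (by linarith)
  simp only [lowerPath, mul_im, ofReal_re, I_im, mul_one, ofReal_im, I_re, mul_zero, add_zero]
  exact div_neg_of_neg_of_pos this (by positivity)

lemma tendsto_lowerPath : Tendsto lowerPath (𝓝[>] 0) (𝓝 0) := by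
  have : ContinuousAt lowerPath 0 := by
    unfold lowerPath
    have : ContinuousAt (fun w : ℝ => Real.log (1 - w)) 0 :=
      ContinuousAt.log (by fun_prop) (by simp)
    fun_prop
  have h := this.tendsto
  rw [show lowerPath 0 = 0 by simp [lowerPath]] at h
  exact h.mono_left nhdsWithin_le_nhds

/-- Only the dilogarithm survives, with -Li₂(1)/(2πi) = πi/12. The endpoint x = 1 lies on the circle
of convergence, hence the use of continuity on the closed disc. -/
lemma tendsto_psiLower_lowerPath :
    Tendsto (fun w => psiLower (lowerPath w)) (𝓝[>] 0) (𝓝 (exp (Real.pi * I / 12))) := by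
  have hpi : (Real.pi : ℂ) ≠ 0 := ofReal_ne_zero.2 Real.pi_ne_zero
  have hev : ∀ᶠ w : ℝ in 𝓝[>] 0, 0 < w ∧ w < 1 := Ioo_mem_nhdsGT one_pos
  have h1 : Tendsto (fun w : ℝ => dilog (1 - w)) (𝓝[>] 0) (𝓝 ((Real.pi : ℂ) ^ 2 / 6)) := by
    rw [← dilog_one]
    refine (continuousOn_dilog 1 (by simp)).tendsto.comp (tendsto_nhdsWithin_iff.2 ⟨?_, ?_⟩)
    · have : Continuous fun w : ℝ => (1 : ℂ) - w := by fun_prop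
      have h := (this.tendsto 0).mono_left (nhdsWithin_le_nhds (s := Ioi 0))
      simpa using h
    · filter_upwards [hev] with w hw
      rw [mem_closedBall_zero_iff, show (1 : ℂ) - w = ((1 - w : ℝ) : ℂ) by push_cast; rfl, norm_real,
        Real.norm_eq_abs, abs_le]
      constructor <;> linarith [hw.1, hw.2]
  have h2 := (Complex.continuous_ofReal.tendsto 0).comp tendsto_log_mul_log_one_sub
  have h3 := ((h2.mul_const (I / (2 * Real.pi))).sub
    (h1.const_mul (1 / (2 * (Real.pi : ℂ) * I)))).cexp
  have he : ((0 : ℝ) : ℂ) * (I / (2 * Real.pi)) -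
      1 / (2 * (Real.pi : ℂ) * I) * ((Real.pi : ℂ) ^ 2 / 6) = Real.pi * I / 12 := by
    field_simp; rw [I_sq]; push_cast; ring
  rw [he] at h3
  refine h3.congr' ?_
  filter_upwards [hev] with w hw
  rw [psiLower, cexpTwoPiI_neg_lowerPath hw.2, sub_sub_cancel, ← ofReal_log hw.1.le, lowerPath]
  simp only [Function.comp_apply]
  congr 2
  push_cast; ring

/-- Equal logarithmic derivatives on a connected set leave a constant factor c. Since `psi` is
continuous at the boundary point 0, comparing limits along `lowerPath` gives c = 1. -/
lemma psi_eq_psiLower {t : ℂ} (ht : t.im < 0) : psi t = psiLower t := by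
  have hdl : DifferentiableOn ℂ psiLower {t : ℂ | t.im < 0} := fun t ht =>
    (hasDerivAt_logPsiLower ht).cexp.differentiableAt.differentiableWithinAt
  have hk : ∀ {t : ℂ}, t.im < 0 → ∀ k : ℕ, t ≠ k + 1 := fun ht k h => by
    rw [h] at ht; simp at ht
  have hk' : ∀ {t : ℂ}, t.im < 0 → ∀ k : ℕ, -t ≠ k + 1 := fun ht k h => by
    rw [neg_eq_iff_eq_neg.1 h] at ht; simp at ht
  have hdp : DifferentiableOn ℂ psi {t : ℂ | t.im < 0} := fun t ht =>
    (differentiableAt_psi (hk' ht)).differentiableWithinAt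
  obtain ⟨c, -, hc⟩ := (logDeriv_eqOn_iff hdl hdp isOpen_lower isPreconnected_lower
    (fun t ht => psi_ne_zero (hk ht) (hk' ht)) (fun t _ => exp_ne_zero _)).1 (by
      intro t ht
      rw [logDeriv_psiLower ht, logDeriv_psi (ne_of_lt ht), cot_pi_eq_exp_ratio, cexpTwoPiI_neg]
      rw [show exp (2 * Real.pi * I * t) = cexpTwoPiI t from rfl]
      have h0 := cexpTwoPiI_ne_zero t
      have h1 : cexpTwoPiI t - 1 ≠ 0 := by
        rw [sub_ne_zero, ne_eq, cexpTwoPiI_eq_one_iff]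
        rintro ⟨n, rfl⟩
        simp at ht
      have h2 : 1 - cexpTwoPiI t ≠ 0 := fun h => h1 (by linear_combination -h)
      have h3 : 1 - (cexpTwoPiI t)⁻¹ ≠ 0 := by
        rw [← one_div, one_sub_div h0]; exact div_ne_zero h1 h0
      generalize cexpTwoPiI t = x at *
      rw [← one_div, one_sub_div h0]
      field_simp
      rw [I_sq]
      ring)
  have hlim : Tendsto (fun w => psiLower (lowerPath w)) (𝓝[>] 0)
      (𝓝 (c * exp (Real.pi * I / 12))) := by
    have hcont : ContinuousAt psi 0 := (differentiableAt_psi (fun k => by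
      rw [neg_zero]; exact (natCast_add_one_complex_ne_zero k).symm)).continuousAt
    have h := (hcont.tendsto.comp tendsto_lowerPath).const_mul c
    rw [psi_zero] at h
    refine h.congr' ?_
    filter_upwards [Ioo_mem_nhdsGT one_pos] with w hw
    exact (hc (lowerPath_im_neg hw.1 hw.2)).symm
  have hc1 := tendsto_nhds_unique hlim tendsto_psiLower_lowerPath
  have : c = 1 := mul_right_cancel₀ (exp_ne_zero _) (hc1.trans (one_mul _).symm)
  have h := hc ht
  rw [this, one_smul] at h
  exact h.symm

lemma isPsiContinuation_psi : IsPsiContinuation psi := by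
  refine ⟨fun t _ => ?_, fun t ht => psi_eq_psiLower ht⟩
  have hd : Differentiable ℂ (fun t => psiNum (-t)) :=
    differentiable_psiNum.comp differentiable_neg
  have hn := differentiable_psiNum
  have hf : Differentiable ℂ
      fun t => exp (Real.pi * I / 12 - Real.pi * I * t ^ 2 / 2 + t) * psiNum t := by fun_prop
  refine MeromorphicNFOn.div (f := fun t =>
    exp (Real.pi * I / 12 - Real.pi * I * t ^ 2 / 2 + t) * psiNum t)
    (g := fun t => psiNum (-t)) (hf.analyticAt t) (hd.analyticAt t).meromorphicNFAt ?_
  -- The numerator vanishes only at positive integers and the denominator only at negative ones;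
  -- without common zeros the quotient is in normal form.
  by_cases h : ∃ k : ℕ, t = k + 1
  · obtain ⟨k, rfl⟩ := h
    refine Or.inl (psiNum_ne_zero fun j hj => ?_)
    have := congrArg re hj
    simp at this
    linarith [j.cast_nonneg (α := ℝ), k.cast_nonneg (α := ℝ)]
  · exact Or.inr (mul_ne_zero (exp_ne_zero _) (psiNum_ne_zero (not_exists.1 h)))

/-- The difference vanishes near -i, so it has infinite order everywhere by connectedness. Normal
forms that agree on a punctured neighbourhood also agree at its centre. -/
lemma IsPsiContinuation.unique {φ ψ : ℂ → ℂ} (hφ : IsPsiContinuation φ)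
    (hψ : IsPsiContinuation ψ) : φ = ψ := by
  have hm : MeromorphicOn (φ - ψ) univ := hφ.1.meromorphicOn.sub hψ.1.meromorphicOn
  have htop : meromorphicOrderAt (φ - ψ) (-I) = ⊤ := by
    rw [meromorphicOrderAt_eq_top_iff]
    refine Filter.Eventually.filter_mono nhdsWithin_le_nhds ?_
    filter_upwards [isOpen_lower.mem_nhds (show (-I).im < 0 by simp)] with t ht
    rw [Pi.sub_apply, hφ.2 ht, hψ.2 ht, sub_self]
  funext x
  have hx : meromorphicOrderAt (φ - ψ) x = ⊤ := by
    by_contra h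
    exact hm.meromorphicOrderAt_ne_top_of_isPreconnected isPreconnected_univ (mem_univ x)
      (mem_univ (-I)) h htop
  rw [meromorphicOrderAt_eq_top_iff] at hx
  refine Filter.EventuallyEq.eq_of_nhds
    ((hφ.1 (mem_univ x)).eventuallyEq_nhdsNE_iff_eventuallyEq_nhds (hψ.1 (mem_univ x)) |>.1 ?_)
  filter_upwards [hx] with y hy
  exact sub_eq_zero.1 hy

/-! ### Functional equations of ψ -/

lemma psi_mul_psi_neg {t : ℂ} (h1 : ∀ k : ℕ, t ≠ k + 1) (h2 : ∀ k : ℕ, -t ≠ k + 1) :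
    psi t * psi (-t) = exp (-(Real.pi * I * (t ^ 2 - 1 / 6))) := by
  have e1 := psiNum_ne_zero h1
  have e2 := psiNum_ne_zero h2
  rw [psi, psi, neg_neg, show -(Real.pi * I * (t ^ 2 - 1 / 6)) =
    (Real.pi * I / 12 - Real.pi * I * t ^ 2 / 2 + t) +
    (Real.pi * I / 12 - Real.pi * I * (-t) ^ 2 / 2 + -t) by ring,
    exp_add (Real.pi * I / 12 - Real.pi * I * t ^ 2 / 2 + t)]
  generalize exp (Real.pi * I / 12 - Real.pi * I * t ^ 2 / 2 + t) = a
  generalize exp (Real.pi * I / 12 - Real.pi * I * (-t) ^ 2 / 2 + -t) = b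
  field_simp

lemma psiLower_add_one {t : ℂ} (ht : t.im < 0) :
    psiLower (t + 1) = psiLower t * (1 - cexpTwoPiI (-t)) := by
  have hper : cexpTwoPiI (-(t + 1)) = cexpTwoPiI (-t) := by
    rw [neg_add, cexpTwoPiI_add, cexpTwoPiI_neg 1, cexpTwoPiI_one, inv_one, mul_one]
  have hs : 1 - cexpTwoPiI (-t) ∈ slitPlane := by
    rw [sub_eq_add_neg]
    exact mem_slitPlane_of_norm_lt_one (by rw [norm_neg]; exact norm_cexpTwoPiI_neg_lt_one ht)
  rw [psiLower, psiLower, hper]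
  generalize dilog (cexpTwoPiI (-t)) = d
  rw [show (t + 1) * log (1 - cexpTwoPiI (-t)) - 1 / (2 * Real.pi * I) * d =
    t * log (1 - cexpTwoPiI (-t)) - 1 / (2 * Real.pi * I) * d + log (1 - cexpTwoPiI (-t)) by ring,
    exp_add, exp_log (slitPlane_ne_zero hs)]

/-- In the lower half plane the equation can be read off from `psiLower`, as e(-t) has period 1.
With denominators cleared it becomes an identity F = G of entire functions, to which the identity
theorem applies. -/
lemma psi_add_one {t : ℂ} (h2 : ∀ k : ℕ, -t ≠ k + 1) :
    psi (t + 1) = psi t * (1 - cexpTwoPiI (-t)) := by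
  have hn := differentiable_psiNum
  have hd : Differentiable ℂ (fun t => psiNum (-t)) := hn.comp differentiable_neg
  have hd1 : Differentiable ℂ (fun t => psiNum (t + 1)) := hn.comp (by fun_prop)
  have hd2 : Differentiable ℂ (fun t => psiNum (-(t + 1))) := hn.comp (by fun_prop)
  have he := differentiable_cexpTwoPiI
  have hde : Differentiable ℂ (fun t => cexpTwoPiI (-t)) := he.comp differentiable_neg
  let E : ℂ → ℂ := fun t => exp (Real.pi * I / 12 - Real.pi * I * t ^ 2 / 2 + t)
  have hE : Differentiable ℂ E := by unfold E; fun_prop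
  let F : ℂ → ℂ := fun t => E (t + 1) * psiNum (t + 1) * psiNum (-t)
  let G : ℂ → ℂ := fun t => E t * psiNum t * psiNum (-(t + 1)) * (1 - cexpTwoPiI (-t))
  have hE1 : Differentiable ℂ (fun t => E (t + 1)) := hE.comp (by fun_prop)
  have hF : Differentiable ℂ F := by unfold F; fun_prop
  have hG : Differentiable ℂ G := by unfold G; fun_prop
  have hk' : ∀ {t : ℂ}, t.im < 0 → psiNum (-t) ≠ 0 := fun ht =>
    psiNum_ne_zero_of_im_ne_zero (by simpa using ht.ne)
  have hFG : F = G := by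
    refine AnalyticOnNhd.eq_of_eventuallyEq (z₀ := -I) (fun t _ => hF.analyticAt t)
      (fun t _ => hG.analyticAt t) ?_
    filter_upwards [isOpen_lower.mem_nhds (show (-I).im < 0 by simp)] with t ht
    have ht1 : (t + 1).im < 0 := by simpa using ht
    have h := psiLower_add_one ht
    rw [← psi_eq_psiLower ht, ← psi_eq_psiLower ht1, psi, psi, div_eq_iff (hk' ht1)] at h
    have h0 := hk' ht
    simp only [F, G, E]
    rw [h]
    field_simp
  have hne := psiNum_ne_zero h2
  have hne1 : psiNum (-(t + 1)) ≠ 0 := psiNum_ne_zero fun k hk => by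
    rcases k with - | k
    · exact absurd (show -t = ((1 : ℕ) : ℂ) + 1 by push_cast at hk ⊢; linear_combination hk) (h2 1)
    · exact absurd (show -t = ((k + 2 : ℕ) : ℂ) + 1 by push_cast at hk ⊢; linear_combination hk)
        (h2 (k + 2))
  have h := congrFun hFG t
  simp only [F, G, E] at h
  rw [psi, psi]
  generalize exp (Real.pi * I / 12 - Real.pi * I * (t + 1) ^ 2 / 2 + (t + 1)) = a at *
  generalize exp (Real.pi * I / 12 - Real.pi * I * t ^ 2 / 2 + t) = b at *
  generalize psiNum (-(t + 1)) = c at *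
  field_simp
  linear_combination h

/-! ### Infinite products in q -/

section OneSubMul

variable {ι : Type*} {c : ι → ℂ}

lemma multipliable_one_sub_mul (hc : Summable fun i => ‖c i‖) (y : ℂ) :
    Multipliable fun i => 1 - y * c i := by
  have : Summable fun i => ‖-(y * c i)‖ := by simpa using hc.mul_left ‖y‖
  simpa [sub_eq_add_neg] using multipliable_one_add_of_summable this

lemma tprod_one_sub_mul_ne_zero (hc : Summable fun i => ‖c i‖) {y : ℂ} (hy : ∀ i, y * c i ≠ 1) :
    ∏' i, (1 - y * c i) ≠ 0 := by
  have : Summable fun i => ‖-(y * c i)‖ := by simpa using hc.mul_left ‖y‖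
  have := tprod_one_add_ne_zero_of_summable (fun i => by
    rw [← sub_eq_add_neg]; exact sub_ne_zero.2 (hy i).symm) this
  simpa [sub_eq_add_neg] using this

lemma differentiable_tprod_one_sub_mul (hc : Summable fun i => ‖c i‖) :
    Differentiable ℂ fun y => ∏' i, (1 - y * c i) := by
  intro y
  have h := Summable.hasProdLocallyUniformlyOn_one_add (f := fun i y => -(y * c i))
    (K := Metric.ball (0 : ℂ) (‖y‖ + 1)) Metric.isOpen_ball (hc.mul_left (‖y‖ + 1))
    (Eventually.of_forall fun i x hx => by
      rw [norm_neg, norm_mul]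
      have := (mem_ball_zero_iff.1 hx).le
      gcongr) (fun i => by fun_prop)
  have hd := TendstoLocallyUniformlyOn.differentiableOn h (Eventually.of_forall fun s => by
    fun_prop) Metric.isOpen_ball
  have := hd.differentiableAt (Metric.isOpen_ball.mem_nhds (x := y) (by simp))
  simpa [sub_eq_add_neg] using this

end OneSubMul

section QProducts

variable {q : ℂ}

lemma summable_norm_pow (hq : ‖q‖ < 1) : Summable fun j : ℕ => ‖q ^ j‖ :=
  (summable_geometric_of_norm_lt_one hq).norm

lemma summable_norm_pow_mul_pow (hq : ‖q‖ < 1) :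
    Summable fun p : ℕ × ℕ => ‖q ^ p.1 * q ^ p.2‖ :=
  (summable_norm_pow hq).mul_norm (summable_norm_pow hq)

lemma multipliable_qProd (hq : ‖q‖ < 1) (x : ℂ) : Multipliable fun j : ℕ => 1 - x * q ^ j :=
  multipliable_one_sub_mul (summable_norm_pow hq) x

lemma qProd_ne_zero (hq : ‖q‖ < 1) {x : ℂ} (hx : ∀ j : ℕ, x * q ^ j ≠ 1) : qProd x q ≠ 0 :=
  tprod_one_sub_mul_ne_zero (summable_norm_pow hq) hx

lemma mul_ne_one_of_norm_lt_one {x y : ℂ} (hx : ‖x‖ < 1) (hy : ‖y‖ ≤ 1) : x * y ≠ 1 := by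
  intro h
  have := congrArg norm h
  rw [norm_mul, norm_one] at this
  nlinarith [norm_nonneg x, norm_nonneg y]

lemma norm_pow_le_one (hq : ‖q‖ < 1) (j : ℕ) : ‖q ^ j‖ ≤ 1 := by
  rw [norm_pow]; exact pow_le_one₀ (norm_nonneg _) hq.le

lemma qProd_ne_zero_of_norm_lt_one (hq : ‖q‖ < 1) {x : ℂ} (hx : ‖x‖ < 1) : qProd x q ≠ 0 :=
  qProd_ne_zero hq fun j => mul_ne_one_of_norm_lt_one hx (norm_pow_le_one hq j)

lemma differentiable_qProd (hq : ‖q‖ < 1) : Differentiable ℂ fun x => qProd x q :=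
  differentiable_tprod_one_sub_mul (summable_norm_pow hq)

lemma qProd_eq_one_sub_mul (hq : ‖q‖ < 1) (x : ℂ) : qProd x q = (1 - x) * qProd (x * q) q := by
  have h : (fun j : ℕ => 1 - x * q ^ (j + 1)) = fun j : ℕ => 1 - x * q * q ^ j := by
    funext j; rw [pow_succ]; ring
  have := tprod_eq_zero_mul' (f := fun j : ℕ => 1 - x * q ^ j)
    (by rw [h]; exact multipliable_qProd hq _)
  rw [qProd, this, h, pow_zero, mul_one]
  rfl

lemma multipliable_qrProd (hq : ‖q‖ < 1) (x : ℂ) :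
    Multipliable fun p : ℕ × ℕ => 1 - x * q ^ p.1 * q ^ p.2 := by
  simpa only [mul_assoc] using multipliable_one_sub_mul (summable_norm_pow_mul_pow hq) x

lemma qrProd_eq (x q : ℂ) :
    qrProd x q q = ∏' p : ℕ × ℕ, (1 - x * (q ^ p.1 * q ^ p.2)) := by
  simp only [qrProd, mul_assoc]

lemma differentiable_qrProd (hq : ‖q‖ < 1) : Differentiable ℂ fun x => qrProd x q q := by
  simp only [qrProd_eq]
  exact differentiable_tprod_one_sub_mul (summable_norm_pow_mul_pow hq)

lemma qrProd_ne_zero (hq : ‖q‖ < 1) {x : ℂ} (hx : ∀ j : ℕ, x * q ^ j ≠ 1) :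
    qrProd x q q ≠ 0 := by
  rw [qrProd_eq]
  refine tprod_one_sub_mul_ne_zero (summable_norm_pow_mul_pow hq) fun p => ?_
  rw [← pow_add]; exact hx _

lemma qrProd_ne_zero_of_norm_lt_one (hq : ‖q‖ < 1) {x : ℂ} (hx : ‖x‖ < 1) : qrProd x q q ≠ 0 :=
  qrProd_ne_zero hq fun j => mul_ne_one_of_norm_lt_one hx (norm_pow_le_one hq j)

lemma qrProd_eq_qProd_mul (hq : ‖q‖ < 1) (x : ℂ) :
    qrProd x q q = qProd x q * qrProd (x * q) q q := by
  have key : ∀ x : ℂ, HasProd (fun j : ℕ => qProd (x * q ^ j) q) (qrProd x q q) := fun x =>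
    HasProd.prod_fiberwise (f := fun p : ℕ × ℕ => 1 - x * q ^ p.1 * q ^ p.2)
      (multipliable_qrProd hq x).hasProd fun j => (multipliable_qProd hq (x * q ^ j)).hasProd
  have h : (fun j : ℕ => qProd (x * q ^ (j + 1)) q) = fun j : ℕ => qProd (x * q * q ^ j) q := by
    funext j; rw [pow_succ]; ring_nf
  have := tprod_eq_zero_mul' (f := fun j : ℕ => qProd (x * q ^ j) q)
    (by rw [h]; exact (key _).multipliable)
  rw [← (key x).tprod_eq, this, h, (key _).tprod_eq, pow_zero, mul_one]

/-- Euler's identity `∏ (1 + q ^ (j + 1)) (1 - q ^ (2 j + 1)) = 1`. -/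
lemma qProd_neg_mul_qProd_sq (hq : ‖q‖ < 1) : qProd (-q) q * qProd q (q ^ 2) = 1 := by
  have hq2 : ‖q ^ 2‖ < 1 := by
    rw [norm_pow]; exact pow_lt_one₀ (norm_nonneg _) hq two_ne_zero
  -- Differences of squares give (q; q)(-q; q) = (q²; q²), and splitting by parity gives (q; q²)(q²;
  -- q²) = (q; q); the nonzero (q; q) is then cancelled.
  have h1 : qProd q q * qProd (-q) q = qProd (q ^ 2) (q ^ 2) := by
    rw [qProd, qProd, ← (multipliable_qProd hq _).tprod_mul (multipliable_qProd hq _)]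
    refine tprod_congr fun j => ?_
    ring
  have h2 : qProd q (q ^ 2) * qProd (q ^ 2) (q ^ 2) = qProd q q := by
    have := tprod_even_mul_odd (f := fun j : ℕ => 1 - q * q ^ j)
      (by convert multipliable_qProd hq2 q using 3 with j; ring)
      (by convert multipliable_qProd hq2 (q ^ 2) using 3 with j; ring)
    rw [qProd, qProd, qProd, ← this]
    congr 1 <;> refine tprod_congr fun j => ?_ <;> ring
  have h3 := qProd_ne_zero_of_norm_lt_one hq hq
  rw [← h1] at h2
  refine mul_left_cancel₀ h3 ?_
  linear_combination h2

end QProducts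

/-! ### Quasi-periodicity of θ₀ and of the elliptic gamma function -/

section Theta

variable {τ : ℂ}

lemma norm_nome (hτ : 0 < τ.im) : ‖cexpTwoPiI τ‖ < 1 := norm_cexpTwoPiI_lt_one hτ

lemma thetaZero_add_one (z τ : ℂ) : thetaZero (z + 1) τ = thetaZero z τ := by
  simp only [thetaZero, cexpTwoPiI_add, cexpTwoPiI_one, mul_one]

lemma thetaZero_ne_zero (hτ : 0 < τ.im) {z : ℂ} (hz : ∀ m n : ℤ, z ≠ m + n * τ) :
    thetaZero z τ ≠ 0 := by
  refine mul_ne_zero (qProd_ne_zero (norm_nome hτ) fun j h => ?_)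
    (qProd_ne_zero (norm_nome hτ) fun j h => ?_)
  · rw [← cexpTwoPiI_natCast_mul, ← cexpTwoPiI_add, cexpTwoPiI_eq_one_iff] at h
    obtain ⟨n, hn⟩ := h
    exact hz n (-j) (by push_cast; linear_combination hn)
  · rw [← cexpTwoPiI_natCast_mul, ← cexpTwoPiI_sub, ← cexpTwoPiI_add, cexpTwoPiI_eq_one_iff] at h
    obtain ⟨n, hn⟩ := h
    exact hz (-n) (j + 1) (by push_cast; linear_combination -hn)

lemma thetaZero_add_tau (hτ : 0 < τ.im) (z : ℂ) :
    thetaZero (z + τ) τ = -cexpTwoPiI (-z) * thetaZero z τ := by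
  have hx := cexpTwoPiI_ne_zero z
  have hq0 := cexpTwoPiI_ne_zero τ
  simp only [thetaZero, cexpTwoPiI_add, cexpTwoPiI_neg]
  rw [qProd_eq_one_sub_mul (norm_nome hτ) (cexpTwoPiI z),
    qProd_eq_one_sub_mul (norm_nome hτ) (cexpTwoPiI τ / (cexpTwoPiI z * cexpTwoPiI τ))]
  have h : cexpTwoPiI τ / (cexpTwoPiI z * cexpTwoPiI τ) = (cexpTwoPiI z)⁻¹ := by field_simp
  rw [h, show (cexpTwoPiI z)⁻¹ * cexpTwoPiI τ = cexpTwoPiI τ / cexpTwoPiI z by field_simp]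
  generalize cexpTwoPiI z = x at *
  field_simp
  ring

lemma thetaZero_eq_one_sub_mul (hτ : 0 < τ.im) (z : ℂ) : thetaZero z τ = (1 - cexpTwoPiI z) *
    (qProd (cexpTwoPiI (z + τ)) (cexpTwoPiI τ) * qProd (cexpTwoPiI (τ - z)) (cexpTwoPiI τ)) := by
  rw [thetaZero, qProd_eq_one_sub_mul (norm_nome hτ), cexpTwoPiI_add, cexpTwoPiI_sub, mul_assoc]

lemma cexpTwoPiI_half : cexpTwoPiI (1 / 2) = -1 := by
  rw [cexpTwoPiI, ← exp_pi_mul_I]; congr 1; ring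

/-- With p = e(τ/2) and q = p², the three values are 2(-q; q)², (p; q)² and (-p; q)². As (p; q)(-p;
q) = (q; q²), Euler's identity leaves 2. -/
lemma thetaZero_half_periods (hτ : 0 < τ.im) :
    thetaZero (1 / 2) τ * thetaZero (τ / 2) τ * thetaZero ((1 + τ) / 2) τ = 2 := by
  have hq := norm_nome hτ
  have hp : ‖cexpTwoPiI (τ / 2)‖ < 1 := norm_cexpTwoPiI_lt_one (by simpa using hτ)
  have hp0 := cexpTwoPiI_ne_zero (τ / 2)
  have hpq : cexpTwoPiI τ = cexpTwoPiI (τ / 2) ^ 2 := by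
    rw [← cexpTwoPiI_natCast_mul]; congr 1; push_cast; ring
  have hE := qProd_neg_mul_qProd_sq hq
  rw [show (1 + τ) / 2 = 1 / 2 + τ / 2 by ring]
  simp only [thetaZero, cexpTwoPiI_add, cexpTwoPiI_half]
  rw [qProd_eq_one_sub_mul hq (-1)]
  have hmul : qProd (cexpTwoPiI (τ / 2)) (cexpTwoPiI τ) * qProd (-cexpTwoPiI (τ / 2)) (cexpTwoPiI τ)
      = qProd (cexpTwoPiI τ) (cexpTwoPiI τ ^ 2) := by
    rw [qProd, qProd, ← (multipliable_qProd hq _).tprod_mul (multipliable_qProd hq _), hpq]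
    exact tprod_congr fun j => by ring
  have e1 : cexpTwoPiI τ / cexpTwoPiI (τ / 2) = cexpTwoPiI (τ / 2) := by rw [hpq]; field_simp
  have e2 : cexpTwoPiI τ / (-1 * cexpTwoPiI (τ / 2)) = -cexpTwoPiI (τ / 2) := by
    rw [hpq]; field_simp
  rw [e1, e2, neg_one_mul, neg_one_mul, div_neg, div_one]
  linear_combination 2 * qProd (-cexpTwoPiI τ) (cexpTwoPiI τ) ^ 2 *
    (qProd (cexpTwoPiI (τ / 2)) (cexpTwoPiI τ) * qProd (-cexpTwoPiI (τ / 2)) (cexpTwoPiI τ) +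
      qProd (cexpTwoPiI τ) (cexpTwoPiI τ ^ 2)) * hmul +
    2 * (qProd (-cexpTwoPiI τ) (cexpTwoPiI τ) * qProd (cexpTwoPiI τ) (cexpTwoPiI τ ^ 2) + 1) * hE

lemma ellipticGamma_add_one (z τ σ : ℂ) : ellipticGamma (z + 1) τ σ = ellipticGamma z τ σ := by
  simp only [ellipticGamma, cexpTwoPiI_add, cexpTwoPiI_one, mul_one]

lemma ellipticGamma_add_tau (hτ : 0 < τ.im) {z : ℂ} (hz : ∀ m n : ℤ, z ≠ m + n * τ) :
    ellipticGamma (z + τ) τ τ = thetaZero z τ * ellipticGamma z τ τ := by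
  have hq := norm_nome hτ
  have hx := cexpTwoPiI_ne_zero z
  have hq0 := cexpTwoPiI_ne_zero τ
  have h0 : qProd (cexpTwoPiI z) (cexpTwoPiI τ) ≠ 0 := left_ne_zero_of_mul (thetaZero_ne_zero hτ hz)
  simp only [ellipticGamma, thetaZero, cexpTwoPiI_add]
  rw [qrProd_eq_qProd_mul hq (cexpTwoPiI z), mul_div_mul_right _ _ hq0,
    qrProd_eq_qProd_mul hq (cexpTwoPiI τ / cexpTwoPiI z), div_mul_eq_mul_div,
    mul_comm (qProd (cexpTwoPiI z) _) (qProd (cexpTwoPiI τ / cexpTwoPiI z) _), mul_assoc,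
    ← mul_div_assoc (qProd (cexpTwoPiI z) _), mul_div_mul_left _ _ h0, mul_div_assoc]

end Theta

/-! ### The period parallelogram and doubly periodic functions -/

section Lattice

/-- `z` does not lie in `ℤ + ℤ τ`. -/
def NotLattice (τ z : ℂ) : Prop := ∀ m n : ℤ, z ≠ m + n * τ

/-- The open parallelogram `{a + b τ | |a| < 1, |b| < 1}`. -/
def periodBox (τ : ℂ) : Set ℂ := {z | |(z / τ).im| < -(τ⁻¹).im ∧ |z.im| < τ.im}

variable {τ z : ℂ}

lemma NotLattice.add_int_mul (h : NotLattice τ z) (m n : ℤ) : NotLattice τ (z + (m + n * τ)) :=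
  fun k l hkl => h (k - m) (l - n) (by push_cast; linear_combination hkl)

lemma NotLattice.add_one (h : NotLattice τ z) : NotLattice τ (z + 1) := by
  simpa using h.add_int_mul 1 0

lemma NotLattice.add_tau (h : NotLattice τ z) : NotLattice τ (z + τ) := by
  simpa using h.add_int_mul 0 1

lemma NotLattice.sub_tau (h : NotLattice τ z) : NotLattice τ (z - τ) := by
  simpa [sub_eq_add_neg] using h.add_int_mul 0 (-1)

lemma NotLattice.neg (h : NotLattice τ z) : NotLattice τ (-z) :=
  fun k l hkl => h (-k) (-l) (by push_cast; linear_combination -hkl)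

lemma ne_zero_of_im_pos (hτ : 0 < τ.im) : τ ≠ 0 := by rintro rfl; simp at hτ

lemma NotLattice.div_ne_int (hτ : 0 < τ.im) (h : NotLattice τ z) (m n : ℤ) :
    (m + z) / τ ≠ n := by
  rw [ne_eq, div_eq_iff (ne_zero_of_im_pos hτ)]
  intro hm
  exact h (-m) n (by push_cast; linear_combination hm)

lemma im_inv_neg (hτ : 0 < τ.im) : (τ⁻¹).im < 0 := by
  rw [inv_im]
  exact div_neg_of_neg_of_pos (by linarith) (normSq_pos.2 (ne_zero_of_im_pos hτ))

lemma exists_coordinates (hτ : 0 < τ.im) (z : ℂ) : ∃ a b : ℝ, z = a + b * τ := by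
  refine ⟨z.re - z.im / τ.im * τ.re, z.im / τ.im, ?_⟩
  apply Complex.ext <;> simp
  field_simp

lemma im_coordinates (a b : ℝ) : ((a : ℂ) + b * τ).im = b * τ.im := by simp

lemma im_coordinates_div (hτ : 0 < τ.im) (a b : ℝ) :
    (((a : ℂ) + b * τ) / τ).im = a * (τ⁻¹).im := by
  have h0 := ne_zero_of_im_pos hτ
  rw [add_div, mul_div_cancel_right₀ _ h0, div_eq_mul_inv]
  simp [-inv_im]

lemma mem_periodBox_iff (hτ : 0 < τ.im) (a b : ℝ) :
    ((a : ℂ) + b * τ) ∈ periodBox τ ↔ |a| < 1 ∧ |b| < 1 := by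
  have h := im_inv_neg hτ
  rw [periodBox, mem_ofPred_eq, im_coordinates, im_coordinates_div hτ, abs_mul, abs_mul,
    abs_of_neg h, abs_of_pos hτ]
  refine and_congr ?_ ?_
  · exact mul_lt_iff_lt_one_left (by linarith)
  · exact mul_lt_iff_lt_one_left hτ

lemma notLattice_of_coordinates (hτ : 0 < τ.im) {a b : ℝ}
    (h : (∀ m : ℤ, a ≠ m) ∨ ∀ n : ℤ, b ≠ n) : NotLattice τ (a + b * τ) := by
  intro m n hmn
  have h1 : b = n := by
    have := congrArg im hmn
    simp only [im_coordinates] at this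
    rw [show ((m : ℂ) + n * τ).im = n * τ.im by simp] at this
    exact mul_right_cancel₀ hτ.ne' this
  have h2 : a = m := by
    rw [h1] at hmn
    push_cast at hmn
    have := add_right_cancel hmn
    exact_mod_cast this
  rcases h with h | h
  · exact h m h2
  · exact h n h1

/-- In coordinates z = a + bτ, the two memberships force -1 < a < 0. Hence functional equations
known only off the lattice apply to every shift inside the box. -/
lemma notLattice_of_mem_add_one (hτ : 0 < τ.im) (h1 : z ∈ periodBox τ)
    (h2 : z + 1 ∈ periodBox τ) : NotLattice τ z := by
  obtain ⟨a, b, rfl⟩ := exists_coordinates hτ z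
  rw [show (a : ℂ) + b * τ + 1 = ((a + 1 : ℝ) : ℂ) + b * τ by push_cast; ring] at h2
  rw [mem_periodBox_iff hτ] at h1 h2
  refine notLattice_of_coordinates hτ (Or.inl ?_)
  rintro m rfl
  have h3 := (abs_lt.1 h1.1).1
  have h4 := (abs_lt.1 h2.1).2
  have : (-1 : ℤ) < m := by exact_mod_cast h3
  have : m + 1 < 1 := by exact_mod_cast h4
  omega

lemma notLattice_of_mem_add_tau (hτ : 0 < τ.im) (h1 : z ∈ periodBox τ)
    (h2 : z + τ ∈ periodBox τ) : NotLattice τ z := by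
  obtain ⟨a, b, rfl⟩ := exists_coordinates hτ z
  rw [show (a : ℂ) + b * τ + τ = (a : ℂ) + ((b + 1 : ℝ) : ℂ) * τ by push_cast; ring] at h2
  rw [mem_periodBox_iff hτ] at h1 h2
  refine notLattice_of_coordinates hτ (Or.inr ?_)
  rintro m rfl
  have h3 := (abs_lt.1 h1.2).1
  have h4 := (abs_lt.1 h2.2).2
  have : (-1 : ℤ) < m := by exact_mod_cast h3
  have : m + 1 < 1 := by exact_mod_cast h4
  omega

lemma isOpen_periodBox (τ : ℂ) : IsOpen (periodBox τ) :=
  (isOpen_lt (continuous_im.comp (continuous_id.div_const τ)).abs continuous_const).inter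
    (isOpen_lt continuous_im.abs continuous_const)

lemma isPreconnected_periodBox (hτ : 0 < τ.im) : IsPreconnected (periodBox τ) := by
  have : periodBox τ = (fun p : ℝ × ℝ => (p.1 : ℂ) + p.2 * τ) '' (Ioo (-1) 1 ×ˢ Ioo (-1) 1) := by
    ext z
    constructor
    · intro hz
      obtain ⟨a, b, rfl⟩ := exists_coordinates hτ z
      rw [mem_periodBox_iff hτ] at hz
      exact ⟨(a, b), ⟨abs_lt.1 hz.1, abs_lt.1 hz.2⟩, rfl⟩
    · rintro ⟨⟨a, b⟩, ⟨ha, hb⟩, rfl⟩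
      exact (mem_periodBox_iff hτ a b).2 ⟨abs_lt.2 ha, abs_lt.2 hb⟩
  rw [this]
  exact (isPreconnected_Ioo.prod isPreconnected_Ioo).image _ (by fun_prop)

lemma zero_mem_periodBox (hτ : 0 < τ.im) : (0 : ℂ) ∈ periodBox τ := by
  have := (mem_periodBox_iff hτ 0 0).2 (by simp)
  simpa using this

lemma neg_mem_periodBox (hz : z ∈ periodBox τ) : -z ∈ periodBox τ := by
  simpa [periodBox, neg_div] using hz

lemma notLattice_of_mem_periodBox (hτ : 0 < τ.im) (hz : z ∈ periodBox τ) (h0 : z ≠ 0) :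
    NotLattice τ z := by
  obtain ⟨a, b, rfl⟩ := exists_coordinates hτ z
  rw [mem_periodBox_iff hτ] at hz
  have key : ∀ {x : ℝ}, |x| < 1 → x ≠ 0 → ∀ m : ℤ, x ≠ m := by
    rintro x hx hx0 m rfl
    refine hx0 ?_
    have : |m| < 1 := by exact_mod_cast hx
    rw [Int.abs_lt_one_iff.1 this, Int.cast_zero]
  by_cases ha : a = 0
  · by_cases hb : b = 0
    · exact absurd (by simp [ha, hb]) h0
    · exact notLattice_of_coordinates hτ (Or.inr (key hz.2 hb))
  · exact notLattice_of_coordinates hτ (Or.inl (key hz.1 ha))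

/-- A holomorphic function on `periodBox τ` with the periods `1` and `τ` is constant. -/
lemma eqOn_const_of_periodic (hτ : 0 < τ.im) {f : ℂ → ℂ} (hf : DifferentiableOn ℂ f (periodBox τ))
    (h1 : ∀ z ∈ periodBox τ, z + 1 ∈ periodBox τ → f (z + 1) = f z)
    (h2 : ∀ z ∈ periodBox τ, z + τ ∈ periodBox τ → f (z + τ) = f z) :
    ∃ c, ∀ z ∈ periodBox τ, f z = c := by
  let g : ℝ × ℝ → ℂ := fun p => (p.1 : ℂ) + p.2 * τ
  have hg : Continuous g := by unfold g; fun_prop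
  -- At most one shift in each direction, made inside the box, brings any point of the box into this
  -- compact set. A maximum of |f| over S is therefore a maximum over the open box, and the maximum
  -- principle applies.
  let S : Set ℂ := g '' (Icc (-1 / 2) (1 / 2) ×ˢ Icc (-1 / 2) (1 / 2))
  have hS : IsCompact S := (isCompact_Icc.prod isCompact_Icc).image hg
  have hSU : S ⊆ periodBox τ := by
    rintro _ ⟨⟨a, b⟩, ⟨ha, hb⟩, rfl⟩
    refine (mem_periodBox_iff hτ a b).2 ⟨abs_lt.2 ⟨?_, ?_⟩, abs_lt.2 ⟨?_, ?_⟩⟩ <;>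
      first | linarith [ha.1] | linarith [ha.2] | linarith [hb.1] | linarith [hb.2]
  have hSne : S.Nonempty := ⟨g (0, 0), mem_image_of_mem g (by constructor <;> simp <;> norm_num)⟩
  obtain ⟨w, hwS, hw⟩ := hS.exists_isMaxOn hSne (hf.continuousOn.mono hSU).norm
  have red1 : ∀ a b : ℝ, |a| < 1 → |b| < 1 → ∃ a' : ℝ, a' ∈ Icc (-1 / 2 : ℝ) (1 / 2) ∧
      f (a + b * τ) = f (a' + b * τ) := by
    intro a b ha hb
    have hm := (mem_periodBox_iff hτ a b).2 ⟨ha, hb⟩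
    rw [abs_lt] at ha
    rcases lt_or_ge (1 / 2) a with h | h
    · refine ⟨a - 1, ⟨by linarith, by linarith⟩, ?_⟩
      have := h1 ((a - 1 : ℝ) + b * τ) ((mem_periodBox_iff hτ (a - 1) b).2
        ⟨abs_lt.2 ⟨by linarith, by linarith⟩, hb⟩)
      rw [show ((a - 1 : ℝ) : ℂ) + b * τ + 1 = a + b * τ by push_cast; ring] at this
      exact this hm
    rcases lt_or_ge a (-1 / 2) with h' | h'
    · refine ⟨a + 1, ⟨by linarith, by linarith⟩, ?_⟩
      have := h1 (a + b * τ) hm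
      rw [show (a : ℂ) + b * τ + 1 = ((a + 1 : ℝ) : ℂ) + b * τ by push_cast; ring] at this
      exact (this ((mem_periodBox_iff hτ (a + 1) b).2
        ⟨abs_lt.2 ⟨by linarith, by linarith⟩, hb⟩)).symm
    · exact ⟨a, ⟨h', h⟩, rfl⟩
  have red2 : ∀ a b : ℝ, |a| < 1 → |b| < 1 → ∃ b' : ℝ, b' ∈ Icc (-1 / 2 : ℝ) (1 / 2) ∧
      f (a + b * τ) = f (a + b' * τ) := by
    intro a b ha hb
    have hm := (mem_periodBox_iff hτ a b).2 ⟨ha, hb⟩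
    rw [abs_lt] at hb
    rcases lt_or_ge (1 / 2) b with h | h
    · refine ⟨b - 1, ⟨by linarith, by linarith⟩, ?_⟩
      have := h2 (a + (b - 1 : ℝ) * τ) ((mem_periodBox_iff hτ a (b - 1)).2
        ⟨ha, abs_lt.2 ⟨by linarith, by linarith⟩⟩)
      rw [show (a : ℂ) + (b - 1 : ℝ) * τ + τ = a + b * τ by push_cast; ring] at this
      exact this hm
    rcases lt_or_ge b (-1 / 2) with h' | h'
    · refine ⟨b + 1, ⟨by linarith, by linarith⟩, ?_⟩
      have := h2 (a + b * τ) hm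
      rw [show (a : ℂ) + b * τ + τ = a + ((b + 1 : ℝ) : ℂ) * τ by push_cast; ring] at this
      exact (this ((mem_periodBox_iff hτ a (b + 1)).2
        ⟨ha, abs_lt.2 ⟨by linarith, by linarith⟩⟩)).symm
    · exact ⟨b, ⟨h', h⟩, rfl⟩
  have hmax : IsMaxOn (norm ∘ f) (periodBox τ) w := by
    intro z hz
    obtain ⟨a, b, rfl⟩ := exists_coordinates hτ z
    obtain ⟨ha, hb⟩ := (mem_periodBox_iff hτ a b).1 hz
    obtain ⟨a', ha', e1⟩ := red1 a b ha hb
    obtain ⟨b', hb', e2⟩ := red2 a' b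
      (abs_lt.2 ⟨by linarith [ha'.1], by linarith [ha'.2]⟩) hb
    have := hw (show g (a', b') ∈ S from mem_image_of_mem g ⟨ha', hb'⟩)
    simp only [Function.comp_apply, mem_ofPred_eq, e1, e2] at this ⊢
    exact this
  exact ⟨f w, fun z hz => eqOn_of_isPreconnected_of_isMaxOn_norm (isPreconnected_periodBox hτ)
    (isOpen_periodBox τ) hf (hSU hwS) hmax hz⟩

/-- A function off the lattice with periods `1` and `τ` is determined by its values on
`periodBox τ`. -/
lemma eq_const_of_periodic (hτ : 0 < τ.im) {f : ℂ → ℂ} {c : ℂ}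
    (hc : ∀ z ∈ periodBox τ, NotLattice τ z → f z = c)
    (h1 : ∀ z, NotLattice τ z → f (z + 1) = f z)
    (h2 : ∀ z, NotLattice τ z → f (z + τ) = f z) (hz : NotLattice τ z) : f z = c := by
  have p1 : ∀ (n : ℕ) (w : ℂ), NotLattice τ w → f (w + n) = f w := by
    intro n
    induction n with
    | zero => intro w _; simp
    | succ n ih =>
      intro w hw
      rw [← ih w hw, ← h1 (w + n) (by simpa using hw.add_int_mul n 0)]
      congr 1; push_cast; ring
  have p2 : ∀ (n : ℕ) (w : ℂ), NotLattice τ w → f (w + n * τ) = f w := by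
    intro n
    induction n with
    | zero => intro w _; simp
    | succ n ih =>
      intro w hw
      rw [← ih w hw, ← h2 (w + n * τ) (by simpa using hw.add_int_mul 0 n)]
      congr 1; push_cast; ring
  have q1 : ∀ (n : ℤ) (w : ℂ), NotLattice τ w → f (w + n) = f w := by
    intro n w hw
    obtain ⟨n, rfl | rfl⟩ := n.eq_nat_or_neg
    · exact_mod_cast p1 n w hw
    · rw [← p1 n (w + _) (by simpa using hw.add_int_mul (-(n : ℤ)) 0)]
      congr 1; push_cast; ring
  have q2 : ∀ (n : ℤ) (w : ℂ), NotLattice τ w → f (w + n * τ) = f w := by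
    intro n w hw
    obtain ⟨n, rfl | rfl⟩ := n.eq_nat_or_neg
    · exact_mod_cast p2 n w hw
    · rw [← p2 n (w + _) (by simpa using hw.add_int_mul 0 (-(n : ℤ)))]
      congr 1; push_cast; ring
  obtain ⟨a, b, rfl⟩ := exists_coordinates hτ z
  have hw := hz.add_int_mul (-⌊a⌋) (-⌊b⌋)
  have e : (a : ℂ) + b * τ + ((-⌊a⌋ : ℤ) + (-⌊b⌋ : ℤ) * τ) =
      (Int.fract a : ℝ) + (Int.fract b : ℝ) * τ := by
    simp only [Int.fract]; push_cast; ring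
  rw [e] at hw
  rw [← hc _ ((mem_periodBox_iff hτ _ _).2 ⟨?_, ?_⟩) hw, ← e, ← add_assoc, q2, q1 _ _ hz]
  · simpa using hz.add_int_mul (-⌊a⌋) 0
  · rw [Int.abs_fract]; exact Int.fract_lt_one a
  · rw [Int.abs_fract]; exact Int.fract_lt_one b

end Lattice

/-! ### Convergence and quasi-periodicity of the ψ-products -/

lemma hasSum_norm_pow_succ {x : ℂ} (hx : ‖x‖ < 1) :
    HasSum (fun n : ℕ => ‖x‖ ^ (n + 1)) (‖x‖ / (1 - ‖x‖)) := by
  simpa [pow_succ, div_eq_inv_mul] using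
    (hasSum_geometric_of_lt_one (norm_nonneg x) hx).mul_right ‖x‖

lemma norm_log_one_sub_le {x : ℂ} (hx : ‖x‖ < 1) : ‖log (1 - x)‖ ≤ ‖x‖ / (1 - ‖x‖) := by
  rw [← norm_neg, ← (hasSum_taylorSeries_neg_log' hx).tsum_eq]
  refine tsum_of_norm_bounded (hasSum_norm_pow_succ hx) fun n => ?_
  rw [norm_div, norm_pow, norm_natCast_add_one]
  exact div_le_self (by positivity) (by linarith [n.cast_nonneg (α := ℝ)])

lemma norm_dilog_le {x : ℂ} (hx : ‖x‖ < 1) : ‖dilog x‖ ≤ ‖x‖ / (1 - ‖x‖) := by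
  refine tsum_of_norm_bounded (hasSum_norm_pow_succ hx) fun n => ?_
  rw [norm_div, norm_pow, norm_pow, norm_natCast_add_one]
  exact div_le_self (by positivity) (one_le_pow₀ (by linarith [n.cast_nonneg (α := ℝ)]))

lemma norm_logPsiLower_le {t : ℂ} (ht : t.im < 0) : ‖logPsiLower t‖ ≤
    (‖t‖ + 1) * (‖cexpTwoPiI (-t)‖ / (1 - ‖cexpTwoPiI (-t)‖)) := by
  have hx := norm_cexpTwoPiI_neg_lt_one ht
  have h1 := norm_log_one_sub_le hx
  have h2 := norm_dilog_le hx
  have hc : ‖1 / (2 * (Real.pi : ℂ) * I)‖ ≤ 1 := by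
    rw [norm_div, norm_mul, norm_mul, norm_I, norm_real, Real.norm_of_nonneg Real.pi_pos.le]
    simp only [norm_one, Complex.norm_ofNat, mul_one]
    rw [div_le_one (by positivity)]
    linarith [Real.pi_gt_three]
  have hnn : 0 ≤ ‖cexpTwoPiI (-t)‖ / (1 - ‖cexpTwoPiI (-t)‖) := (norm_nonneg _).trans h1
  refine (norm_sub_le _ _).trans ?_
  rw [norm_mul, norm_mul, add_mul]
  gcongr

section PsiProd

variable {τ z : ℂ}

/-- The product of the `psi ((k + 1 + z) / τ)`. -/
def psiProd (τ z : ℂ) : ℂ := ∏' k : ℕ, psi ((k + 1 + z) / τ)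

lemma im_arg (τ z : ℂ) (k : ℕ) : ((k + 1 + z) / τ).im = (k + 1) * (τ⁻¹).im + (z / τ).im := by
  rw [add_div, add_im, div_eq_mul_inv]
  congr 1
  rw [mul_im]; simp [-inv_im]

lemma exists_bound_logPsiLower (hτ : 0 < τ.im) {ε : ℝ} (hε : 0 < ε) (R : ℝ) :
    ∃ u : ℕ → ℝ, Summable u ∧ ∀ k : ℕ, ∀ z : ℂ, (z / τ).im < -(τ⁻¹).im - ε → ‖z‖ < R →
      ((k + 1 + z) / τ).im < 0 ∧ ‖logPsiLower ((k + 1 + z) / τ)‖ ≤ u k := by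
  have hδ := im_inv_neg hτ
  have hpi := Real.pi_pos
  have hτ0 : 0 < ‖τ‖ := norm_pos_iff.2 (ne_zero_of_im_pos hτ)
  set δ := (τ⁻¹).im
  set r := Real.exp (2 * Real.pi * δ)
  set ρ := Real.exp (-(2 * Real.pi * ε))
  have hr : r < 1 := Real.exp_lt_one_iff.2 (by nlinarith)
  have hρ : ρ < 1 := Real.exp_lt_one_iff.2 (by nlinarith [mul_pos hpi hε])
  have hr0 : 0 < r := Real.exp_pos _
  have hρ0 : 0 < ρ := Real.exp_pos _
  -- ρ r ^ k bounds |e(-(k+1+z)/τ)|: the margin ε yields ρ, and each increment of k lowers the bound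
  -- on the imaginary part by |Im(1/τ)|. Also 1 - ρ bounds 1 - |e(-(k+1+z)/τ)| from below.
  refine ⟨fun k => ((k + 1 + R) / ‖τ‖ + 1) * (ρ * r ^ k / (1 - ρ)), ?_, ?_⟩
  · have h1 := summable_pow_mul_geometric_of_norm_lt_one 1 (r := r)
      (by rwa [Real.norm_of_nonneg hr0.le])
    have h2 := summable_geometric_of_lt_one hr0.le hr
    refine ((h1.mul_left (ρ / (‖τ‖ * (1 - ρ)))).add
      (h2.mul_left (((1 + R) / ‖τ‖ + 1) * (ρ / (1 - ρ))))).congr fun k => ?_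
    have : 1 - ρ ≠ 0 := by linarith
    field_simp
    ring
  · intro k z hz hzR
    have him : ((k + 1 + z) / τ).im < -ε + k * δ := by
      rw [im_arg]; linarith
    have hneg : ((k + 1 + z) / τ).im < 0 := by
      nlinarith [k.cast_nonneg (α := ℝ)]
    refine ⟨hneg, (norm_logPsiLower_le hneg).trans ?_⟩
    have hx : ‖cexpTwoPiI (-((k + 1 + z) / τ))‖ ≤ ρ * r ^ k := by
      rw [norm_cexpTwoPiI, ← Real.exp_nat_mul, ← Real.exp_add, neg_im]
      refine Real.exp_le_exp.2 ?_
      nlinarith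
    have hx1 : ρ * r ^ k ≤ ρ := mul_le_of_le_one_right hρ0.le (pow_le_one₀ hr0.le hr.le)
    have ht : ‖((k : ℂ) + 1 + z) / τ‖ ≤ (k + 1 + R) / ‖τ‖ := by
      rw [norm_div]
      gcongr
      exact (norm_add_le _ _).trans (by rw [norm_natCast_add_one]; linarith)
    have : 0 < 1 - ρ := by linarith
    have : 0 ≤ R := (norm_nonneg z).trans hzR.le
    have hnn : 0 ≤ ‖cexpTwoPiI (-((k + 1 + z) / τ))‖ / (1 - ‖cexpTwoPiI (-((k + 1 + z) / τ))‖) :=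
      div_nonneg (norm_nonneg _) (by linarith)
    beta_reduce
    gcongr
    exact hx.trans hx1

lemma exists_nhds_bound (hτ : 0 < τ.im) (hz : (z / τ).im < -(τ⁻¹).im) :
    ∃ V : Set ℂ, IsOpen V ∧ z ∈ V ∧ ∃ u : ℕ → ℝ, Summable u ∧ ∀ k : ℕ, ∀ w ∈ V,
      ((k + 1 + w) / τ).im < 0 ∧ ‖logPsiLower ((k + 1 + w) / τ)‖ ≤ u k := by
  obtain ⟨u, hu, hb⟩ := exists_bound_logPsiLower hτ
    (ε := (-(τ⁻¹).im - (z / τ).im) / 2) (by linarith) (‖z‖ + 1)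
  refine ⟨{w | (w / τ).im < -(τ⁻¹).im - (-(τ⁻¹).im - (z / τ).im) / 2} ∩ {w | ‖w‖ < ‖z‖ + 1},
    (isOpen_lt (continuous_im.comp (continuous_id.div_const τ)) continuous_const).inter
      (isOpen_lt continuous_norm continuous_const), ⟨?_, ?_⟩, u, hu, fun k w hw => hb k w hw.1 hw.2⟩
  · change (z / τ).im < _
    linarith
  · change ‖z‖ < ‖z‖ + 1
    linarith

lemma hasProd_psiProd_aux (hτ : 0 < τ.im) (hz : (z / τ).im < -(τ⁻¹).im) :
    HasProd (fun k : ℕ => psi ((k + 1 + z) / τ))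
      (exp (∑' k : ℕ, logPsiLower ((k + 1 + z) / τ))) := by
  obtain ⟨V, -, hzV, u, hu, hb⟩ := exists_nhds_bound hτ hz
  have hs : Summable fun k : ℕ => logPsiLower ((k + 1 + z) / τ) :=
    Summable.of_norm_bounded hu fun k => (hb k z hzV).2
  convert! hs.hasSum.cexp using 2 with k
  rw [psi_eq_psiLower (hb k z hzV).1]
  rfl

lemma psiProd_eq_exp (hτ : 0 < τ.im) (hz : (z / τ).im < -(τ⁻¹).im) :
    psiProd τ z = exp (∑' k : ℕ, logPsiLower ((k + 1 + z) / τ)) :=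
  (hasProd_psiProd_aux hτ hz).tprod_eq

lemma differentiableAt_psiProd (hτ : 0 < τ.im) (hz : (z / τ).im < -(τ⁻¹).im) :
    DifferentiableAt ℂ (psiProd τ) z := by
  obtain ⟨V, hVo, hzV, u, hu, hb⟩ := exists_nhds_bound hτ hz
  have hd := differentiableOn_tsum_of_summable_norm hu
    (F := fun (k : ℕ) z => logPsiLower ((k + 1 + z) / τ)) (fun k w hw => by
      have h := (hasDerivAt_logPsiLower (hb k w hw).1).differentiableAt
      have h2 : DifferentiableAt ℂ (fun w : ℂ => (k + 1 + w) / τ) w := by fun_prop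
      exact (h.comp w h2).differentiableWithinAt) hVo (fun k w hw => (hb k w hw).2)
  have h := (hd.differentiableAt (hVo.mem_nhds hzV)).cexp
  refine h.congr_of_eventuallyEq ?_
  have hop : IsOpen {w : ℂ | (w / τ).im < -(τ⁻¹).im} :=
    isOpen_lt (continuous_im.comp (continuous_id.div_const τ)) continuous_const
  filter_upwards [hop.mem_nhds hz] with w hw
  exact psiProd_eq_exp hτ hw

lemma psiProd_shift (k : ℕ) (τ z : ℂ) :
    psi (((k + 1 : ℕ) + 1 + z) / τ) = psi ((k + 1 + (z + 1)) / τ) := by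
  congr 2; push_cast; ring

lemma NotLattice.psi_arg (hτ : 0 < τ.im) (hz : NotLattice τ z) (m : ℤ) :
    (∀ k : ℕ, (m + z) / τ ≠ k + 1) ∧ (∀ k : ℕ, -((m + z) / τ) ≠ k + 1) := by
  refine ⟨fun k h => hz.div_ne_int hτ m (k + 1) (by push_cast; exact h), fun k h =>
    hz.div_ne_int hτ m (-(k + 1)) (by push_cast; linear_combination -h)⟩

lemma NotLattice.psi_ne_zero (hτ : 0 < τ.im) (hz : NotLattice τ z) (m : ℤ) :
    psi ((m + z) / τ) ≠ 0 :=
  _root_.psi_ne_zero (hz.psi_arg hτ m).1 (hz.psi_arg hτ m).2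

lemma psiProd_step (hτ : 0 < τ.im) (hz : NotLattice τ z)
    (h : Multipliable (fun k : ℕ => psi ((k + 1 + (z + 1)) / τ)) ∧ psiProd τ (z + 1) ≠ 0) :
    Multipliable (fun k : ℕ => psi ((k + 1 + z) / τ)) ∧ psiProd τ z ≠ 0 ∧
      psiProd τ z = psi ((1 + z) / τ) * psiProd τ (z + 1) := by
  have h1 : HasProd (fun k : ℕ => psi (((k + 1 : ℕ) + 1 + z) / τ)) (psiProd τ (z + 1)) := by
    simp only [psiProd_shift]; exact h.1.hasProd
  have h2 := HasProd.zero_mul (f := fun k : ℕ => psi ((k + 1 + z) / τ)) h1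
  have h3 : psiProd τ z = psi ((1 + z) / τ) * psiProd τ (z + 1) := by
    have := h2.tprod_eq
    simpa [psiProd] using this
  refine ⟨h2.multipliable, ?_, h3⟩
  rw [h3]
  have := hz.psi_ne_zero hτ 1
  exact mul_ne_zero (by simpa using this) h.2

/-- On the half plane where every argument has negative imaginary part the product is an
exponential. Since z ↦ z + 1 lowers Im(z/τ), induction reaches all other points by splitting off one
factor at a time; off the lattice that factor is neither a zero nor a pole. -/
lemma multipliable_psiProd_and_ne_zero (hτ : 0 < τ.im) (hz : NotLattice τ z) :
    Multipliable (fun k : ℕ => psi ((k + 1 + z) / τ)) ∧ psiProd τ z ≠ 0 := by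
  have key : ∀ (n : ℕ) (z : ℂ), NotLattice τ z → (z / τ).im < -((n + 1) * (τ⁻¹).im) →
      Multipliable (fun k : ℕ => psi ((k + 1 + z) / τ)) ∧ psiProd τ z ≠ 0 := by
    intro n
    induction n with
    | zero =>
      intro z _ h
      have h' : (z / τ).im < -(τ⁻¹).im := by simpa [-inv_im] using h
      refine ⟨(hasProd_psiProd_aux hτ h').multipliable, ?_⟩
      rw [psiProd_eq_exp hτ h']; exact exp_ne_zero _
    | succ n ih =>
      intro z hz h
      have := psiProd_step hτ hz (ih (z + 1) hz.add_one (by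
        rw [add_div, add_im, one_div]; push_cast at h; linarith))
      exact ⟨this.1, this.2.1⟩
  have hδ := im_inv_neg hτ
  obtain ⟨n, hn⟩ := exists_nat_gt ((z / τ).im / -(τ⁻¹).im)
  refine key n z hz ?_
  rw [div_lt_iff₀ (by linarith)] at hn
  linarith

lemma psiProd_eq_mul (hτ : 0 < τ.im) (hz : NotLattice τ z) :
    psiProd τ z = psi ((1 + z) / τ) * psiProd τ (z + 1) :=
  (psiProd_step hτ hz (multipliable_psiProd_and_ne_zero hτ hz.add_one)).2.2

lemma im_neg_one_div_pos (hτ : 0 < τ.im) : 0 < (-1 / τ).im := by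
  have := im_inv_neg hτ
  rw [neg_div, one_div, neg_im]
  linarith

lemma psiProd_add_tau (hτ : 0 < τ.im) (hz : NotLattice τ z) :
    psiProd τ (z + τ) = psiProd τ z * qProd (cexpTwoPiI (-((1 + z) / τ))) (cexpTwoPiI (-1 / τ)) := by
  have hq := norm_nome (im_neg_one_div_pos hτ)
  have h0 := ne_zero_of_im_pos hτ
  rw [psiProd, psiProd, qProd,
    ← (multipliable_psiProd_and_ne_zero hτ hz).1.tprod_mul (multipliable_qProd hq _)]
  refine tprod_congr fun k => ?_
  have harg : ((k : ℂ) + 1 + (z + τ)) / τ = (k + 1 + z) / τ + 1 := by field_simp; ring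
  have h2 := (hz.psi_arg hτ (k + 1)).2
  push_cast at h2
  rw [harg, psi_add_one h2, ← cexpTwoPiI_natCast_mul, ← cexpTwoPiI_add]
  congr 4
  field_simp
  ring

/-- The quotient of products in the main formula. -/
def psiQuotient (τ z : ℂ) : ℂ := psiProd τ z / (psi (-(z / τ)) * psiProd τ (-z))

lemma hasProd_psi_sub (hτ : 0 < τ.im) (hz : NotLattice τ z) :
    HasProd (fun k : ℕ => psi ((k - z) / τ)) (psi (-(z / τ)) * psiProd τ (-z)) := by
  have h1 : HasProd (fun k : ℕ => psi (((k + 1 : ℕ) - z) / τ)) (psiProd τ (-z)) := by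
    have := (multipliable_psiProd_and_ne_zero hτ hz.neg).1.hasProd
    simpa [sub_eq_add_neg, psiProd] using this
  have := HasProd.zero_mul (f := fun k : ℕ => psi ((k - z) / τ)) h1
  simpa [neg_div] using this

lemma psi_neg_div_mul_ne_zero (hτ : 0 < τ.im) (hz : NotLattice τ z) :
    psi (-(z / τ)) * psiProd τ (-z) ≠ 0 := by
  have h := hz.neg.psi_ne_zero hτ 0
  rw [Int.cast_zero, zero_add, neg_div] at h
  exact mul_ne_zero h (multipliable_psiProd_and_ne_zero hτ hz.neg).2

lemma hasProd_psiQuotient (hτ : 0 < τ.im) (hz : NotLattice τ z) :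
    HasProd (fun k : ℕ => psi ((k + 1 + z) / τ) / psi ((k - z) / τ)) (psiQuotient τ z) :=
  (multipliable_psiProd_and_ne_zero hτ hz).1.hasProd.div₀ (hasProd_psi_sub hτ hz)
    (psi_neg_div_mul_ne_zero hτ hz)

lemma psiQuotient_ne_zero (hτ : 0 < τ.im) (hz : NotLattice τ z) : psiQuotient τ z ≠ 0 :=
  div_ne_zero (multipliable_psiProd_and_ne_zero hτ hz).2 (psi_neg_div_mul_ne_zero hτ hz)

/-- The shift removes ψ(s) from the numerator and adds ψ(-s) to the denominator, with s = (1 + z)/τ;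
the reflection formula evaluates the product ψ(s)ψ(-s). -/
lemma psiQuotient_add_one (hτ : 0 < τ.im) (hz : NotLattice τ z) : psiQuotient τ (z + 1) =
    psiQuotient τ z * exp (Real.pi * I * (((1 + z) / τ) ^ 2 - 1 / 6)) := by
  have hs := hz.psi_arg hτ 1
  have hs0 := hz.psi_ne_zero hτ 1
  push_cast at hs hs0
  have hrefl := psi_mul_psi_neg hs.1 hs.2
  have hstep := psiProd_eq_mul hτ hz
  have hstep2 := psiProd_eq_mul hτ hz.add_one.neg
  have e1 : (1 + -(z + 1)) / τ = -(z / τ) := by ring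
  have e2 : -(z + 1) + 1 = -z := by ring
  have e3 : -((z + 1) / τ) = -((1 + z) / τ) := by ring
  rw [e1, e2] at hstep2
  have hB := psi_neg_div_mul_ne_zero hτ hz
  have hn0 : psi (-((1 + z) / τ)) ≠ 0 := by
    have := psi_neg_div_mul_ne_zero hτ hz.add_one
    rw [e3] at this
    exact left_ne_zero_of_mul this
  rw [psiQuotient, psiQuotient, hstep2, hstep, e3,
    ← neg_neg (Real.pi * I * (((1 + z) / τ) ^ 2 - 1 / 6)), exp_neg, ← hrefl]
  have hb1 := left_ne_zero_of_mul hB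
  have hb2 := right_ne_zero_of_mul hB
  field_simp

/-- Arguments move by ±1, so `psi_add_one` produces q-products with nome e(-1/τ). The numerator
supplies one half of the theta function, and the denominator, shifted the opposite way, the other
half. -/
lemma psiQuotient_add_tau (hτ : 0 < τ.im) (hz : NotLattice τ z) : psiQuotient τ (z + τ) =
    psiQuotient τ z * thetaZero (z / τ) (-1 / τ) := by
  have h0 := ne_zero_of_im_pos hτ
  have hq := norm_nome (im_neg_one_div_pos hτ)
  have hB := psi_neg_div_mul_ne_zero hτ hz.add_tau
  have hB' := psi_neg_div_mul_ne_zero hτ hz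
  have hA := psiProd_add_tau hτ hz.add_tau.neg
  rw [show -(z + τ) + τ = -z by ring] at hA
  have e1 : cexpTwoPiI (-((1 + -(z + τ)) / τ)) = cexpTwoPiI (z / τ) * cexpTwoPiI (-1 / τ) := by
    rw [show -((1 + -(z + τ)) / τ) = z / τ + -1 / τ + 1 by field_simp; ring, cexpTwoPiI_add _ 1,
      cexpTwoPiI_one, mul_one, cexpTwoPiI_add]
  have e2 : cexpTwoPiI (-((1 + z) / τ)) = cexpTwoPiI (-1 / τ) / cexpTwoPiI (z / τ) := by
    rw [show -((1 + z) / τ) = -1 / τ - z / τ by field_simp; ring, cexpTwoPiI_sub]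
  have hpsi : psi (-(z / τ)) = psi (-((z + τ) / τ)) * (1 - cexpTwoPiI (z / τ)) := by
    have h2 := (hz.add_tau.neg.psi_arg hτ 0).2
    simp only [Int.cast_zero, zero_add, neg_div] at h2
    have := psi_add_one h2
    rw [show -((z + τ) / τ) + 1 = -(z / τ) by field_simp; ring, neg_neg,
      show (z + τ) / τ = z / τ + 1 by field_simp, cexpTwoPiI_add, cexpTwoPiI_one, mul_one] at this
    rw [this, show (z + τ) / τ = z / τ + 1 by field_simp]
  have hden : psi (-(z / τ)) * psiProd τ (-z) = psi (-((z + τ) / τ)) * psiProd τ (-(z + τ)) *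
      qProd (cexpTwoPiI (z / τ)) (cexpTwoPiI (-1 / τ)) := by
    rw [hA, e1, hpsi, qProd_eq_one_sub_mul hq (cexpTwoPiI (z / τ))]
    ring
  rw [hden] at hB'
  have hq1 := right_ne_zero_of_mul hB'
  rw [psiQuotient, psiQuotient, psiProd_add_tau hτ hz, e2, hden, thetaZero]
  generalize psi (-((z + τ) / τ)) * psiProd τ (-(z + τ)) = B at *
  generalize qProd (cexpTwoPiI (z / τ)) (cexpTwoPiI (-1 / τ)) = C at *
  field_simp

end PsiProd

/-! ### The modular transformation of θ₀, up to a cube root of unity -/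

section ThetaRatio

variable {τ z : ℂ}

/-- The exponent in the modular transformation of `thetaZero`. -/
def thetaExponent (τ z : ℂ) : ℂ := z ^ 2 / τ + z / τ - z + τ / 6 + 1 / (6 * τ) - 1 / 2

/-- The quotient of the two sides of the modular transformation of `thetaZero`. -/
def thetaRatio (τ z : ℂ) : ℂ :=
  thetaZero z τ * exp (Real.pi * I * thetaExponent τ z) / thetaZero (z / τ) (-1 / τ)

lemma NotLattice.div (hτ : 0 < τ.im) (hz : NotLattice τ z) : NotLattice (-1 / τ) (z / τ) := by
  have h0 := ne_zero_of_im_pos hτ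
  intro m n h
  refine hz (-n) m ?_
  field_simp at h
  push_cast
  linear_combination h

lemma neg_cexpTwoPiI (w : ℂ) : -cexpTwoPiI w = exp (Real.pi * I + 2 * Real.pi * I * w) := by
  rw [exp_add, exp_pi_mul_I, neg_one_mul]; rfl

lemma thetaZero_div_add_one (hτ : 0 < τ.im) (z : ℂ) : thetaZero (z / τ) (-1 / τ) =
    -cexpTwoPiI (-((z + 1) / τ)) * thetaZero ((z + 1) / τ) (-1 / τ) := by
  rw [← thetaZero_add_tau (im_neg_one_div_pos hτ)]
  congr 1; ring

lemma thetaRatio_add_one (hτ : 0 < τ.im) (hz : NotLattice τ z) :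
    thetaRatio τ (z + 1) = thetaRatio τ z := by
  have h0 := ne_zero_of_im_pos hτ
  have hne := thetaZero_ne_zero (im_neg_one_div_pos hτ) (hz.add_one.div hτ)
  have hB : exp (Real.pi * I * thetaExponent τ (z + 1)) * -cexpTwoPiI (-((z + 1) / τ)) =
      exp (Real.pi * I * thetaExponent τ z) := by
    rw [neg_cexpTwoPiI, ← exp_add]
    congr 1
    simp only [thetaExponent]
    field_simp
    ring
  have hc : -cexpTwoPiI (-((z + 1) / τ)) ≠ 0 := neg_ne_zero.2 (cexpTwoPiI_ne_zero _)
  rw [thetaRatio, thetaRatio, thetaZero_div_add_one hτ z, thetaZero_add_one, ← hB]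
  generalize -cexpTwoPiI (-((z + 1) / τ)) = c at *
  field_simp

lemma thetaRatio_add_tau (hτ : 0 < τ.im) (z : ℂ) : thetaRatio τ (z + τ) = thetaRatio τ z := by
  have h0 := ne_zero_of_im_pos hτ
  have hB : -cexpTwoPiI (-z) * exp (Real.pi * I * thetaExponent τ (z + τ)) =
      exp (Real.pi * I * thetaExponent τ z) := by
    rw [neg_cexpTwoPiI, ← exp_add, ← exp_periodic (Real.pi * I * thetaExponent τ z)]
    congr 1
    simp only [thetaExponent]
    field_simp
    ring
  rw [thetaRatio, thetaRatio, thetaZero_add_tau hτ, show (z + τ) / τ = z / τ + 1 by field_simp,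
    thetaZero_add_one, ← hB]
  ring

lemma norm_cexpTwoPiI_add_lt_one {w σ : ℂ} (h : |w.im| < σ.im) : ‖cexpTwoPiI (w + σ)‖ < 1 :=
  norm_cexpTwoPiI_lt_one (by rw [add_im]; linarith [(abs_lt.1 h).1])

lemma norm_cexpTwoPiI_sub_lt_one {w σ : ℂ} (h : |w.im| < σ.im) : ‖cexpTwoPiI (σ - w)‖ < 1 :=
  norm_cexpTwoPiI_lt_one (by rw [sub_im]; linarith [(abs_lt.1 h).2])

lemma neg_one_div_im (τ : ℂ) : (-1 / τ).im = -(τ⁻¹).im := by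
  rw [neg_div, one_div, neg_im]

/-- `thetaZero` with its factor vanishing at the integers removed. -/
def thetaRest (τ z : ℂ) : ℂ :=
  qProd (cexpTwoPiI (z + τ)) (cexpTwoPiI τ) * qProd (cexpTwoPiI (τ - z)) (cexpTwoPiI τ)

lemma differentiable_thetaRest (hτ : 0 < τ.im) : Differentiable ℂ (thetaRest τ) := by
  have h1 := differentiable_qProd (norm_nome hτ)
  have he := differentiable_cexpTwoPiI
  have e1 : Differentiable ℂ fun z => qProd (cexpTwoPiI (z + τ)) (cexpTwoPiI τ) :=
    h1.comp (he.comp (by fun_prop))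
  have e2 : Differentiable ℂ fun z => qProd (cexpTwoPiI (τ - z)) (cexpTwoPiI τ) :=
    h1.comp (he.comp (by fun_prop))
  exact e1.mul e2

lemma thetaRest_ne_zero (hτ : 0 < τ.im) (h : |z.im| < τ.im) : thetaRest τ z ≠ 0 :=
  mul_ne_zero (qProd_ne_zero_of_norm_lt_one (norm_nome hτ) (norm_cexpTwoPiI_add_lt_one h))
    (qProd_ne_zero_of_norm_lt_one (norm_nome hτ) (norm_cexpTwoPiI_sub_lt_one h))

lemma one_sub_cexpTwoPiI_div_ne_zero (hτ : 0 < τ.im) (hz : z ∈ periodBox τ) (h0 : z ≠ 0) :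
    1 - cexpTwoPiI (z / τ) ≠ 0 := by
  rw [sub_ne_zero, ne_comm, ne_eq, cexpTwoPiI_eq_one_iff]
  rintro ⟨n, hn⟩
  refine notLattice_of_mem_periodBox hτ hz h0 0 n ?_
  rw [div_eq_iff (ne_zero_of_im_pos hτ)] at hn
  simpa using hn

/-- In the box both theta functions vanish only at 0, through the factors g and h. Replacing these
by their difference quotients at 0 removes the singularity, since h has derivative -2πi/τ ≠ 0 there.
-/
lemma exists_differentiableOn_thetaRatio (hτ : 0 < τ.im) :
    ∃ f : ℂ → ℂ, DifferentiableOn ℂ f (periodBox τ) ∧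
      ∀ z ∈ periodBox τ, z ≠ 0 → f z = thetaRatio τ z := by
  have hτ0 := ne_zero_of_im_pos hτ
  have hσ := im_neg_one_div_pos hτ
  let g : ℂ → ℂ := fun z => 1 - cexpTwoPiI z
  let h : ℂ → ℂ := fun z => 1 - cexpTwoPiI (z / τ)
  have hg : Differentiable ℂ g := (differentiable_const 1).sub differentiable_cexpTwoPiI
  have hh : Differentiable ℂ h :=
    (differentiable_const 1).sub (differentiable_cexpTwoPiI.comp (by fun_prop))
  have hdg : Differentiable ℂ (dslope g 0) :=
    differentiableOn_univ.1 ((differentiableOn_dslope univ_mem).2 hg.differentiableOn)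
  have hdh : Differentiable ℂ (dslope h 0) :=
    differentiableOn_univ.1 ((differentiableOn_dslope univ_mem).2 hh.differentiableOn)
  have hg0 : g 0 = 0 := by simp [g, cexpTwoPiI_zero]
  have hh0 : h 0 = 0 := by simp [h, cexpTwoPiI_zero]
  have hr1 := differentiable_thetaRest hτ
  have hr2 : Differentiable ℂ fun z => thetaRest (-1 / τ) (z / τ) :=
    (differentiable_thetaRest hσ).comp (by fun_prop)
  have hE : Differentiable ℂ fun z => exp (Real.pi * I * thetaExponent τ z) := by
    unfold thetaExponent; fun_prop
  have hrest : ∀ z ∈ periodBox τ, thetaRest (-1 / τ) (z / τ) ≠ 0 := fun z hz =>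
    thetaRest_ne_zero hσ (by rw [neg_one_div_im]; exact hz.1)
  refine ⟨fun z => dslope g 0 z * thetaRest τ z * exp (Real.pi * I * thetaExponent τ z) /
    (dslope h 0 z * thetaRest (-1 / τ) (z / τ)), fun z hz => ?_, fun z hz hz0 => ?_⟩
  · refine DifferentiableAt.differentiableWithinAt (DifferentiableAt.div
      (((hdg z).mul (hr1 z)).mul (hE z)) ((hdh z).mul (hr2 z)) (mul_ne_zero ?_ (hrest z hz)))
    by_cases hz0 : z = 0
    · rw [hz0, dslope_same]
      have hd : HasDerivAt h (-(2 * Real.pi * I * (1 / τ))) 0 := by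
        have := ((((hasDerivAt_id (0 : ℂ)).div_const τ).const_mul (2 * (Real.pi : ℂ) * I)).cexp).const_sub 1
        refine this.congr_deriv ?_
        simp
      rw [hd.deriv]
      exact neg_ne_zero.2 (mul_ne_zero two_pi_I_ne_zero (one_div_ne_zero hτ0))
    · rw [dslope_of_ne _ hz0, slope_def_field, hh0]
      simp only [sub_zero]
      exact div_ne_zero (one_sub_cexpTwoPiI_div_ne_zero hτ hz hz0) hz0
  · have h1 := one_sub_cexpTwoPiI_div_ne_zero hτ hz hz0
    have h2 := hrest z hz
    simp only [dslope_of_ne _ hz0, slope_def_field, hh0, hg0, sub_zero]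
    rw [thetaRatio, thetaZero_eq_one_sub_mul hτ, thetaZero_eq_one_sub_mul hσ]
    simp only [g, h, thetaRest] at h2 ⊢
    generalize cexpTwoPiI (z / τ) = X at *
    generalize qProd (cexpTwoPiI (z / τ + -1 / τ)) (cexpTwoPiI (-1 / τ)) *
      qProd (cexpTwoPiI (-1 / τ - z / τ)) (cexpTwoPiI (-1 / τ)) = A at *
    generalize exp (Real.pi * I * thetaExponent τ z) = e at *
    field_simp

lemma exists_thetaRatio_eq_const (hτ : 0 < τ.im) :
    ∃ c : ℂ, ∀ z, NotLattice τ z → thetaRatio τ z = c := by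
  obtain ⟨f, hf, hfr⟩ := exists_differentiableOn_thetaRatio hτ
  have hne : ∀ {z}, NotLattice τ z → z ≠ 0 := fun h h0 => h 0 0 (by simp [h0])
  obtain ⟨c, hc⟩ := eqOn_const_of_periodic hτ hf
    (fun z hz hz1 => by
      have hn := notLattice_of_mem_add_one hτ hz hz1
      rw [hfr z hz (hne hn), hfr _ hz1 (hne hn.add_one), thetaRatio_add_one hτ hn])
    (fun z hz hz1 => by
      have hn := notLattice_of_mem_add_tau hτ hz hz1
      rw [hfr z hz (hne hn), hfr _ hz1 (hne hn.add_tau), thetaRatio_add_tau hτ])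
  refine ⟨c, fun z hz => eq_const_of_periodic hτ (fun w hw hn => ?_)
    (fun w hw => thetaRatio_add_one hτ hw) (fun w _ => thetaRatio_add_tau hτ w) hz⟩
  rw [← hfr w hw (hne hn), hc w hw]

/-- Division by τ permutes the half periods modulo the lattice of -1/τ, so both theta products are
known to be 2 up to quasi-periodicity factors. As the ratio is a constant c, this says c³ = 1, which
suffices later. -/
lemma thetaRatio_half_periods (hτ : 0 < τ.im) :
    thetaRatio τ (1 / 2) * thetaRatio τ (τ / 2) * thetaRatio τ ((1 + τ) / 2) = 1 := by
  have h0 := ne_zero_of_im_pos hτ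
  have hσ := im_neg_one_div_pos hτ
  have hT := thetaZero_half_periods hτ
  have hT' := thetaZero_half_periods hσ
  have e1 : thetaZero (-1 / τ / 2) (-1 / τ) =
      -cexpTwoPiI (-1 / τ / 2) * thetaZero (1 / 2 / τ) (-1 / τ) := by
    have := thetaZero_add_tau hσ (1 / 2 / τ)
    rwa [show 1 / 2 / τ + -1 / τ = -1 / τ / 2 by ring,
      show -(1 / 2 / τ) = -1 / τ / 2 by ring] at this
  have e2 : τ / 2 / τ = 1 / 2 := by field_simp
  have e3 : thetaZero ((1 + -1 / τ) / 2) (-1 / τ) =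
      cexpTwoPiI (-1 / τ / 2) * thetaZero ((1 + τ) / 2 / τ) (-1 / τ) := by
    have := thetaZero_add_tau hσ ((1 + τ) / 2 / τ)
    rwa [show (1 + τ) / 2 / τ + -1 / τ = (1 + -1 / τ) / 2 by field_simp; ring,
      show -((1 + τ) / 2 / τ) = -1 / τ / 2 - 1 / 2 by field_simp; ring, cexpTwoPiI_sub,
      cexpTwoPiI_half, div_neg, div_one, neg_neg] at this
  have e4 : exp (Real.pi * I * thetaExponent τ (1 / 2)) *
      exp (Real.pi * I * thetaExponent τ (τ / 2)) *
      exp (Real.pi * I * thetaExponent τ ((1 + τ) / 2)) * cexpTwoPiI (-1 / τ / 2) ^ 2 = -1 := by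
    rw [← cexpTwoPiI_natCast_mul, cexpTwoPiI, ← exp_add, ← exp_add, ← exp_add]
    refine Eq.trans ?_ exp_pi_mul_I
    rw [← exp_periodic]
    congr 1
    simp only [thetaExponent]
    push_cast
    field_simp
    ring
  have h1 : thetaZero (1 / 2 / τ) (-1 / τ) ≠ 0 := by
    intro h; rw [e1, h] at hT'; simp at hT'
  have h2 : thetaZero (1 / 2) (-1 / τ) ≠ 0 := by
    intro h; rw [h] at hT'; simp at hT'
  have h3 : thetaZero ((1 + τ) / 2 / τ) (-1 / τ) ≠ 0 := by
    intro h; rw [e3, h] at hT'; simp at hT'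
  rw [e1, e3] at hT'
  rw [thetaRatio, thetaRatio, thetaRatio, e2]
  have hp := cexpTwoPiI_ne_zero (-1 / τ / 2)
  generalize cexpTwoPiI (-1 / τ / 2) = p at *
  generalize thetaZero (1 / 2 / τ) (-1 / τ) = d₁ at *
  generalize thetaZero (1 / 2) (-1 / τ) = d₂ at *
  generalize thetaZero ((1 + τ) / 2 / τ) (-1 / τ) = d₃ at *
  field_simp
  refine mul_right_cancel₀ (pow_ne_zero 2 hp) ?_
  linear_combination 2 * e4 + exp (Real.pi * I * thetaExponent τ (1 / 2)) *
      exp (Real.pi * I * thetaExponent τ (τ / 2)) *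
      exp (Real.pi * I * thetaExponent τ ((1 + τ) / 2)) * p ^ 2 * hT + hT'

end ThetaRatio

/-! ### Comparison of the two sides -/

section GammaRatio

variable {τ z : ℂ}

/-- The quotient of the two sides of the product formula for the elliptic gamma function, at the
argument `z + τ`. -/
def gammaRatio (τ z : ℂ) : ℂ :=
  ellipticGamma (z + τ) τ τ * exp (Real.pi * I * cubicQ (z + τ) τ τ) *
    (psi (-(z / τ)) * psiProd τ (-z)) / psiProd τ z

lemma gammaRatio_eq_div (τ z : ℂ) : gammaRatio τ z =
    ellipticGamma (z + τ) τ τ * exp (Real.pi * I * cubicQ (z + τ) τ τ) / psiQuotient τ z := by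
  rw [gammaRatio, psiQuotient, div_div_eq_mul_div]

lemma gammaRatio_add_one (hτ : 0 < τ.im) (hz : NotLattice τ z) :
    gammaRatio τ (z + 1) = gammaRatio τ z := by
  have h0 := ne_zero_of_im_pos hτ
  have hQ : exp (Real.pi * I * cubicQ (z + τ + 1) τ τ) = exp (Real.pi * I * cubicQ (z + τ) τ τ) *
      exp (Real.pi * I * (((1 + z) / τ) ^ 2 - 1 / 6)) := by
    rw [← exp_add]
    congr 1
    simp only [cubicQ]
    field_simp
    ring
  rw [gammaRatio_eq_div, gammaRatio_eq_div, psiQuotient_add_one hτ hz,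
    show z + 1 + τ = z + τ + 1 by ring, ellipticGamma_add_one, hQ, ← mul_assoc,
    mul_div_mul_right _ _ (exp_ne_zero _)]

/-- The gamma function contributes θ₀(z + τ, τ), the ψ-quotient θ₀(z/τ, -1/τ); the increment of
`cubicQ` and the quasi-period factor of θ₀ make up exactly `thetaExponent`, modulo 2πi in the
exponent. -/
lemma gammaRatio_add_tau (hτ : 0 < τ.im) (hz : NotLattice τ z) :
    gammaRatio τ (z + τ) = thetaRatio τ z * gammaRatio τ z := by
  have h0 := ne_zero_of_im_pos hτ
  have hQ : -cexpTwoPiI (-z) * exp (Real.pi * I * cubicQ (z + τ + τ) τ τ) =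
      exp (Real.pi * I * thetaExponent τ z) * exp (Real.pi * I * cubicQ (z + τ) τ τ) := by
    rw [neg_cexpTwoPiI, ← exp_add, ← exp_add,
      ← exp_periodic (Real.pi * I * thetaExponent τ z + _)]
    congr 1
    simp only [cubicQ, thetaExponent]
    field_simp
    ring
  rw [gammaRatio_eq_div, gammaRatio_eq_div, psiQuotient_add_tau hτ hz,
    ellipticGamma_add_tau hτ hz.add_tau, thetaZero_add_tau hτ, thetaRatio, div_mul_div_comm]
  rw [show -cexpTwoPiI (-z) * thetaZero z τ * ellipticGamma (z + τ) τ τ *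
    exp (Real.pi * I * cubicQ (z + τ + τ) τ τ) = thetaZero z τ * ellipticGamma (z + τ) τ τ *
    (-cexpTwoPiI (-z) * exp (Real.pi * I * cubicQ (z + τ + τ) τ τ)) by ring, hQ]
  congr 1 <;> ring

/-- At x = q the two double products in Γ coincide, and Q(τ; τ, τ) = -1/12 cancels ψ(0) =
exp(πi/12). -/
lemma gammaRatio_zero (hτ : 0 < τ.im) : gammaRatio τ 0 = 1 := by
  have h0 := ne_zero_of_im_pos hτ
  have hA : psiProd τ 0 ≠ 0 := by
    rw [psiProd_eq_exp hτ (by simpa [-inv_im] using im_inv_neg hτ)]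
    exact exp_ne_zero _
  have hG : ellipticGamma τ τ τ = 1 := by
    rw [ellipticGamma, mul_div_cancel_right₀ _ (cexpTwoPiI_ne_zero τ)]
    exact div_self (qrProd_ne_zero_of_norm_lt_one (norm_nome hτ) (norm_nome hτ))
  rw [gammaRatio, zero_add, hG, neg_zero, zero_div, neg_zero, psi_zero, one_mul, ← mul_assoc,
    mul_div_cancel_right₀ _ hA, ← exp_add, ← exp_zero]
  congr 1
  simp only [cubicQ]
  field_simp
  ring

lemma ellipticGamma_add_tau_eq (τ z : ℂ) : ellipticGamma (z + τ) τ τ =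
    qrProd (cexpTwoPiI (τ - z)) (cexpTwoPiI τ) (cexpTwoPiI τ) /
      qrProd (cexpTwoPiI (z + τ)) (cexpTwoPiI τ) (cexpTwoPiI τ) := by
  rw [ellipticGamma, ← cexpTwoPiI_add, ← cexpTwoPiI_sub, show τ + τ - (z + τ) = τ - z by ring]

/-- The two conditions defining the box serve separately: |Im z| < Im τ makes |e(τ ± z)| < 1, and
the bound on Im(z/τ) makes both ψ-products exponentials. Moreover ±z/τ is never a nonzero integer
there, so the remaining ψ-factor is regular and nonzero, also at z = 0. -/
lemma differentiableAt_gammaRatio_and_ne_zero (hτ : 0 < τ.im) (hz : z ∈ periodBox τ) :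
    DifferentiableAt ℂ (gammaRatio τ) z ∧ gammaRatio τ z ≠ 0 := by
  have hq := norm_nome hτ
  have hqr := differentiable_qrProd hq
  have he := differentiable_cexpTwoPiI
  have d1 : Differentiable ℂ fun z =>
      qrProd (cexpTwoPiI (τ - z)) (cexpTwoPiI τ) (cexpTwoPiI τ) := hqr.comp (he.comp (by fun_prop))
  have d2 : Differentiable ℂ fun z =>
      qrProd (cexpTwoPiI (z + τ)) (cexpTwoPiI τ) (cexpTwoPiI τ) := hqr.comp (he.comp (by fun_prop))
  have n1 := qrProd_ne_zero_of_norm_lt_one hq (norm_cexpTwoPiI_sub_lt_one hz.2)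
  have n2 := qrProd_ne_zero_of_norm_lt_one hq (norm_cexpTwoPiI_add_lt_one hz.2)
  have d3 : Differentiable ℂ fun z => exp (Real.pi * I * cubicQ (z + τ) τ τ) := by
    unfold cubicQ; fun_prop
  have hz1 : (z / τ).im < -(τ⁻¹).im := (abs_lt.1 hz.1).2
  have hz2 : (-z / τ).im < -(τ⁻¹).im := (abs_lt.1 (neg_mem_periodBox hz).1).2
  have d4 := differentiableAt_psiProd hτ hz1
  have n4 : psiProd τ z ≠ 0 := by rw [psiProd_eq_exp hτ hz1]; exact exp_ne_zero _
  have d5 : DifferentiableAt ℂ (fun z => psiProd τ (-z)) z :=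
    (differentiableAt_psiProd hτ hz2).comp z differentiable_neg.differentiableAt
  have n5 : psiProd τ (-z) ≠ 0 := by rw [psiProd_eq_exp hτ hz2]; exact exp_ne_zero _
  have harg : (∀ k : ℕ, -(z / τ) ≠ k + 1) ∧ ∀ k : ℕ, -(-(z / τ)) ≠ k + 1 := by
    by_cases hz0 : z = 0
    · subst hz0
      simp only [zero_div, neg_zero]
      exact ⟨fun k => (natCast_add_one_complex_ne_zero k).symm,
        fun k => (natCast_add_one_complex_ne_zero k).symm⟩
    · have h := (notLattice_of_mem_periodBox hτ hz hz0).psi_arg hτ 0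
      simp only [Int.cast_zero, zero_add] at h
      rw [neg_neg]
      exact ⟨h.2, h.1⟩
  have d6 : DifferentiableAt ℂ (fun z => psi (-(z / τ))) z := by
    have h2 : DifferentiableAt ℂ (fun z : ℂ => -(z / τ)) z := by fun_prop
    exact (differentiableAt_psi harg.2).comp z h2
  have n6 := psi_ne_zero harg.1 harg.2
  have heq : gammaRatio τ = fun z => qrProd (cexpTwoPiI (τ - z)) (cexpTwoPiI τ) (cexpTwoPiI τ) /
      qrProd (cexpTwoPiI (z + τ)) (cexpTwoPiI τ) (cexpTwoPiI τ) *
      exp (Real.pi * I * cubicQ (z + τ) τ τ) *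
      (psi (-(z / τ)) * psiProd τ (-z)) / psiProd τ z := by
    funext z; rw [gammaRatio, ellipticGamma_add_tau_eq]
  rw [heq]
  exact ⟨((((d1 z).div (d2 z) n2).mul (d3 z)).mul (d6.mul d5)).div d4 n4,
    div_ne_zero (mul_ne_zero (mul_ne_zero (div_ne_zero n1 n2) (exp_ne_zero _))
      (mul_ne_zero n6 n5)) n4⟩

lemma logDeriv_add_period {f : ℂ → ℂ} {c p : ℂ} (hc : c ≠ 0)
    (h : ∀ᶠ w in 𝓝 z, f (w + p) = c * f w) : logDeriv f (z + p) = logDeriv f z := by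
  have h1 : logDeriv (fun w => f (w + p)) z = logDeriv f (z + p) := by
    rw [logDeriv_apply, logDeriv_apply, deriv_comp_add_const]
  rw [← h1, (logDeriv_congr_nhds h).eq_of_nhds]
  rw [logDeriv_apply, deriv_const_mul_field, logDeriv_apply, mul_div_mul_left _ _ hc]

lemma exists_gammaRatio_eq_exp (hτ : 0 < τ.im) {c : ℂ} (hc0 : c ≠ 0)
    (hc : ∀ z, NotLattice τ z → thetaRatio τ z = c) :
    ∃ α : ℂ, ∀ z ∈ periodBox τ, gammaRatio τ z = exp (α * z) := by
  have hU := isOpen_periodBox τ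
  have hd : DifferentiableOn ℂ (gammaRatio τ) (periodBox τ) := fun z hz =>
    (differentiableAt_gammaRatio_and_ne_zero hτ hz).1.differentiableWithinAt
  have hne : ∀ z ∈ periodBox τ, gammaRatio τ z ≠ 0 := fun z hz =>
    (differentiableAt_gammaRatio_and_ne_zero hτ hz).2
  have hshift : ∀ p z : ℂ, z + p ∈ periodBox τ → ∀ᶠ w in 𝓝 z, w + p ∈ periodBox τ := fun p z hz =>
    (continuous_add_const p).continuousAt.eventually_mem (hU.mem_nhds hz)
  obtain ⟨α, hα⟩ := eqOn_const_of_periodic hτ (f := logDeriv (gammaRatio τ))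
    ((hd.deriv hU).div hd hne)
    (fun z hz hz1 => logDeriv_add_period one_ne_zero (by
      filter_upwards [hU.mem_nhds hz, hshift 1 z hz1] with w hw hw1
      rw [gammaRatio_add_one hτ (notLattice_of_mem_add_one hτ hw hw1), one_mul]))
    (fun z hz hz1 => logDeriv_add_period hc0 (by
      filter_upwards [hU.mem_nhds hz, hshift τ z hz1] with w hw hw1
      have hn := notLattice_of_mem_add_tau hτ hw hw1
      rw [gammaRatio_add_tau hτ hn, hc w hn]))
  have hexp : ∀ z, HasDerivAt (fun z => exp (α * z)) (exp (α * z) * α) z := fun z => by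
    simpa using ((hasDerivAt_id z).const_mul α).cexp
  obtain ⟨C, -, hC⟩ := (logDeriv_eqOn_iff hd (g := fun z => exp (α * z))
    (fun z _ => (hexp z).differentiableAt.differentiableWithinAt) hU (isPreconnected_periodBox hτ)
    (fun z _ => exp_ne_zero _) hne).1 (fun z hz => by
      rw [hα z hz, logDeriv_apply, (hexp z).deriv, mul_div_cancel_left₀ _ (exp_ne_zero _)])
  have h0 := hC (zero_mem_periodBox hτ)
  rw [gammaRatio_zero hτ] at h0
  simp only [Pi.smul_apply, mul_zero, exp_zero, smul_eq_mul, mul_one] at h0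
  refine ⟨α, fun z hz => ?_⟩
  rw [hC hz, ← h0, one_smul]

lemma half_periods_notLattice (hτ : 0 < τ.im) : NotLattice τ (1 / 2) ∧ NotLattice τ (τ / 2) ∧
    NotLattice τ ((1 + τ) / 2) := by
  have key : ∀ n : ℤ, (1 / 2 : ℝ) ≠ n := fun n h => by
    have : (1 : ℤ) = 2 * n := by
      have : (1 : ℝ) = 2 * n := by linarith
      exact_mod_cast this
    omega
  refine ⟨?_, ?_, ?_⟩
  · have := notLattice_of_coordinates (a := 1 / 2) (b := 0) hτ (Or.inl key)
    convert this using 1; push_cast; ring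
  · have := notLattice_of_coordinates (a := 0) (b := 1 / 2) hτ (Or.inr key)
    convert this using 1; push_cast; ring
  · have := notLattice_of_coordinates (a := 1 / 2) (b := 1 / 2) hτ (Or.inr key)
    convert this using 1; push_cast; ring

lemma gammaRatio_eq_one (hτ : 0 < τ.im) (hz : NotLattice τ z) : gammaRatio τ z = 1 := by
  obtain ⟨c, hc⟩ := exists_thetaRatio_eq_const hτ
  obtain ⟨n1, n2, n3⟩ := half_periods_notLattice hτ
  have hc3 := thetaRatio_half_periods hτ
  rw [hc _ n1, hc _ n2, hc _ n3] at hc3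
  have hc0 : c ≠ 0 := by rintro rfl; simp at hc3
  obtain ⟨α, hα⟩ := exists_gammaRatio_eq_exp hτ hc0 hc
  -- A base point w for which w + 1 and w + τ also lie in the box, so that both shifts can be
  -- compared with exp(αz).
  have m0 := (mem_periodBox_iff hτ (-1 / 2) (-1 / 2)).2 (by norm_num [abs_lt])
  have m1 := (mem_periodBox_iff hτ (1 / 2) (-1 / 2)).2 (by norm_num [abs_lt])
  have m2 := (mem_periodBox_iff hτ (-1 / 2) (1 / 2)).2 (by norm_num [abs_lt])
  set w : ℂ := ((-1 / 2 : ℝ) : ℂ) + ((-1 / 2 : ℝ) : ℂ) * τ with hw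
  have e1 : ((1 / 2 : ℝ) : ℂ) + ((-1 / 2 : ℝ) : ℂ) * τ = w + 1 := by rw [hw]; push_cast; ring
  have e2 : ((-1 / 2 : ℝ) : ℂ) + ((1 / 2 : ℝ) : ℂ) * τ = w + τ := by rw [hw]; push_cast; ring
  rw [e1] at m1
  rw [e2] at m2
  have hwn := notLattice_of_mem_add_one hτ m0 m1
  have h1 := gammaRatio_add_one hτ hwn
  have h2 := gammaRatio_add_tau hτ hwn
  rw [hα _ m0, hα _ m1, mul_add, exp_add, mul_one] at h1
  rw [hc w hwn, hα _ m0, hα _ m2, mul_add, exp_add, mul_comm] at h2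
  have h1' : exp α = 1 := mul_left_cancel₀ (exp_ne_zero _) (h1.trans (mul_one _).symm)
  have h2' : exp (α * τ) = c := mul_right_cancel₀ (exp_ne_zero _) h2
  have h3 : exp (3 * (α * τ)) = 1 := by
    rw [show 3 * (α * τ) = α * τ + α * τ + α * τ by ring, exp_add, exp_add, h2', hc3]
  obtain ⟨n, hn⟩ := exp_eq_one_iff.1 h1'
  obtain ⟨m, hm⟩ := exp_eq_one_iff.1 h3
  -- From α = 2πi n and 3ατ = 2πi m; the imaginary part of 3nτ = m then forces n = 0.
  have hnm : (3 * n : ℂ) * τ = m := by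
    refine mul_right_cancel₀ two_pi_I_ne_zero ?_
    rw [← hm, hn]; ring
  have hn0 : n = 0 := by
    have := congrArg im hnm
    have h4 : ((3 * n : ℂ) * τ).im = 3 * n * τ.im := by
      rw [show (3 * n : ℂ) = ((3 * n : ℝ) : ℂ) by push_cast; rfl, im_ofReal_mul]
    rw [h4, intCast_im] at this
    rcases mul_eq_zero.1 this with h | h
    · have : (n : ℝ) = 0 := by linarith
      exact_mod_cast this
    · exact absurd h hτ.ne'
  have hα0 : α = 0 := by rw [hn, hn0]; simp
  have hc1 : c = 1 := by rw [← h2', hα0]; simp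
  refine eq_const_of_periodic hτ (fun w hw _ => ?_) (fun w hw => gammaRatio_add_one hτ hw)
    (fun w hw => ?_) hz
  · rw [hα w hw, hα0]; simp
  · rw [gammaRatio_add_tau hτ hw, hc w hw, hc1, one_mul]

/-- The product formula for the elliptic gamma function with equal periods. -/
lemma ellipticGamma_eq_psiQuotient (hτ : 0 < τ.im) (hz : NotLattice τ z) :
    ellipticGamma z τ τ = exp (-(Real.pi * I * cubicQ z τ τ)) / thetaZero (z / τ) (-1 / τ) *
      psiQuotient τ z := by
  have h0 := ne_zero_of_im_pos hτ
  have hθ := thetaZero_ne_zero (im_neg_one_div_pos hτ) (hz.div hτ)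
  have h1 := gammaRatio_eq_one hτ hz.sub_tau
  -- Dividing the ψ-quotient at z by θ₀(z/τ, -1/τ) gives the ψ-quotient at z - τ, which is the one
  -- in `gammaRatio` at z - τ.
  have h2 := psiQuotient_add_tau hτ hz.sub_tau
  have h3 : thetaZero ((z - τ) / τ) (-1 / τ) = thetaZero (z / τ) (-1 / τ) := by
    rw [← thetaZero_add_one]
    congr 1; field_simp; ring
  rw [sub_add_cancel, h3] at h2
  rw [gammaRatio_eq_div, sub_add_cancel, div_eq_one_iff_eq (psiQuotient_ne_zero hτ hz.sub_tau)]
    at h1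
  rw [h2, ← h1, exp_neg]
  have := exp_ne_zero (Real.pi * I * cubicQ z τ τ)
  generalize exp (Real.pi * I * cubicQ z τ τ) = e at *
  generalize thetaZero (z / τ) (-1 / τ) = d at *
  field_simp

end GammaRatio

end

theorem mainTheorem6 :
    ∃ ψ : ℂ → ℂ,
      IsPsiContinuation ψ ∧ (∀ φ : ℂ → ℂ, IsPsiContinuation φ → φ = ψ) ∧
      ∀ τ z : ℂ, 0 < τ.im → (∀ m n : ℤ, z ≠ (m : ℂ) + (n : ℂ) * τ) →
        Multipliable (fun k : ℕ => ψ (((k : ℂ) + 1 + z) / τ) / ψ (((k : ℂ) - z) / τ)) ∧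
        ellipticGamma z τ τ =
          Complex.exp (-((Real.pi : ℂ) * Complex.I * cubicQ z τ τ)) / thetaZero (z / τ) (-1 / τ) *
            ∏' k : ℕ, (ψ (((k : ℂ) + 1 + z) / τ) / ψ (((k : ℂ) - z) / τ)) := by
  refine ⟨psi, isPsiContinuation_psi, fun φ hφ => hφ.unique isPsiContinuation_psi,
    fun τ z hτ hz => ?_⟩
  have h := hasProd_psiQuotient hτ hz
  refine ⟨h.multipliable, ?_⟩
  rw [h.tprod_eq]
  exact ellipticGamma_eq_psiQuotient hτ hz
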